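/- **Setting.** Let $\mathbb{R}_{\min}=\mathbb{R}\cup\{+\infty\}$ be the min-plus semiring ($\oplus=\min$, $\otimes=+$, zero element $+\infty$, unit $0$). For an $n\times n$ matrix $A$ over $\mathbb{R}_{\min}$ let $G(A)$ be the directed graph on $\{1,\dots,n\}$ with an arc $(i,j)$ iff $A_{ij}\neq+\infty$. A circuit of a graph is a closed path with at least one arc; for a circuit $c$ of $G(A)$, $|c|_A$ is the sum of the entries of $A$ along its arcs, $|c|$ its number of arcs, and $|c|_C$ the number of its arcs with initial node in $C$. Let $A$ be irreducible (any two nodes, equal or not, are joined by a path of $G(A)$ with at least one arc). The minimal circuit mean is $\rho_{\min}(A)=\min_c |c|_A/|c|$; circuits attaining it are critical, and the critical graph $G^c(A)$ consists of the nodes and arcs of the critical circuits. For $\lambda\in\mathbb{R}$, $C$ a set of indices and $N$ its complement, the min-plus Schur complement is $\mathrm{Schur}(C,\lambda,A)=A_{NN}\oplus A_{NC}(\lambda^{-1}A_{CC})^*\lambda^{-1}A_{CN}$ with $B^*=\inf_{k\ge 0}B^k$ (entrywise, min-plus powers); it is indexed by $N$. Put $A_1=A$ and, for $\ell\geq 1$,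 $\alpha_\ell=\rho_{\min}(A_\ell)$, $C_\ell$ = the set of critical nodes of $A_\ell$, $C^\ell=C_1\cup\dots\cup C_\ell$ ($C^0=\emptyset$), and, as long as $C^\ell\ne\{1,\dots,n\}$, $A_{\ell+1}=\mathrm{Schur}(C_\ell,\alpha_\ell,A_\ell)$; let $k$ be the first index with $C^k=\{1,\dots,n\}$. For $1\le\ell\le k$, a circuit $c$ of $G(A)$ is critical of order $\ell$ if $$|c|_A-\sum_{m<\ell}\alpha_m|c|_{C_m}=\alpha_\ell\Bigl(|c|-\sum_{m<\ell}|c|_{C_m}\Bigr),$$ and $G^c_\ell(A)$ is the graph formed by the nodes and arcs of these circuits; $G^c_0(A)$ is the empty graph. A graph has a disjoint circuit cover if some pairwise disjoint elementary circuits of it contain all its nodes (the empty graph has one). Let $D=\mathrm{diag}(d_1,\dots,d_n)$ with $d_j=\alpha_m$ for $j\in C_m$, and let $\hat A=D^{-1}A$, i.e. $\hat A_{ij}=A_{ij}-d_i$. Let $G$ be either $G^c(\hat A)$ or, for some eigenvector $V$ of $\hat A$, the saturation graph, which has an arc $(i,j)$ iff $(\hat AV)_i=\hat A_{ij}\otimes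 V_j$. For $a\in\mathbb{C}^{n\times n}$ let $a^G$ be obtained from $a$ by replacing by $0$ the entries that are not on arcs of $G$. Put $r^\ell=(a^G)_{C^{\ell-1}C^{\ell-1}}$ (the empty matrix is invertible). When $r^\ell$ is invertible, $s^\ell$ is the conventional Schur complement of $C^{\ell-1}$ in $a^G$, and $t^\ell=(s^\ell)_{C_\ell C_\ell}$. A property of $a\in\mathbb{C}^{n\times n}$ holds generically if there is a non-zero polynomial in the entries of $a$ that vanishes at every $a$ for which the property fails. Let $\mathcal{C}$ be the set of germs at $0^+$ of continuous functions $f:(0,\epsilon_0)\to\mathbb{C}$ with $|f(\epsilon)|\le\epsilon^{-\kappa}$ for some constant $\kappa>0$. For $z\in\mathbb{C}$ write $f(\epsilon)\simeq z\epsilon^{x}$ if $\epsilon^{-x}f(\epsilon)\to z$ as $\epsilon\to0^+$ ($x\in\mathbb{R}$), and $f\simeq z\epsilon^{+\infty}$ if $f=0$ near $0$; if $z\ne 0$ and $x\in\mathbb{R}$ one writes $f\sim z\epsilon^x$. **Proposition.** Let $A\in\mathbb{R}_{\min}^{n\times n}$ be irreducible and let $1\le\ell\le k$. Assume that $G^c_{\ell-1}(A)$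 and $G^c_\ell(A)$ have disjoint circuit covers. Then: 1. for each choice of $G$ as above, $r^\ell$ and $t^\ell$ are invertible for generic $a\in\mathbb{C}^{n\times n}$; 2. for generic $a\in\mathbb{C}^{n\times n}$ the following holds for every matrix $\mathcal{A}\in\mathcal{C}^{n\times n}$ with $(\mathcal{A}_\epsilon)_{ij}\simeq a_{ij}\epsilon^{A_{ij}}$ for all $i,j$: the number of eigenvalues of $\mathcal{A}_\epsilon$, counted with multiplicities, that have an equivalent $\lambda\epsilon^{\alpha_\ell}$ with $\lambda\in\mathbb{C}\setminus\{0\}$ is $|C_\ell|$. That is, for small $\epsilon>0$ the eigenvalues of $\mathcal{A}_\epsilon$ can be enumerated, with multiplicities, as $\mathcal{L}^1_\epsilon,\dots,\mathcal{L}^n_\epsilon$ so that exactly $|C_\ell|$ of the functions $\mathcal{L}^i$ satisfy $\mathcal{L}^i_\epsilon\sim\lambda_i\epsilon^{\alpha_\ell}$ for some $\lambda_i\neq0$, while each of the others satisfies $\mathcal{L}^i_\epsilon=o(\epsilon^{\alpha_\ell})$ or $|\mathcal{L}^i_\epsilon|\epsilon^{-\alpha_\ell}\to+\infty$; and in every enumeration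 of the eigenvalues by elements of $\mathcal{C}$ exactly $|C_\ell|$ members have such an equivalent. -/

import Mathlib

open Filter Topology

noncomputable section

namespace MinPlus

/-- The min-plus semiring `ℝ ∪ {+∞}`: `+` is `min`, `*` is the usual addition,
`0` is `+∞` and `1` is the real number zero. -/
abbrev Rmin : Type := Tropical (WithTop ℝ)

/-- A real number, seen as an element of the min-plus semiring. -/
def ofReal (x : ℝ) : Rmin := Tropical.trop (x : WithTop ℝ)

variable {ι : Type} [Fintype ι] [DecidableEq ι]

/-! ### Graphs, circuits, critical graphs

A directed graph is given by its arc relation. A circuit of length `k ≥ 1` is a sequence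
of nodes `c 0, …, c (k - 1), c k = c 0` (not necessarily distinct); the values of `c`
beyond `k` play no role. -/

/-- The arcs of the graph `G(A)`. -/
def arcs (A : Matrix ι ι Rmin) (i j : ι) : Prop := A i j ≠ 0

/-- `A` is irreducible: any two nodes `i`, `j` (also `i = j`) are joined by a path of `G(A)`
with at least one arc. For matrices of size at least two this is strong connectedness
of `G(A)`; the `1 × 1` matrix `(+∞)`, which has no circuit, is excluded. -/
def IsIrreducible (A : Matrix ι ι Rmin) : Prop := ∀ i j, Relation.TransGen (arcs A) i j

/-- `c` is a circuit of length `k` of the graph with arc relation `R`. -/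
def IsCircuit (R : ι → ι → Prop) (k : ℕ) (c : ℕ → ι) : Prop :=
  0 < k ∧ c k = c 0 ∧ ∀ m < k, R (c m) (c (m + 1))

/-- The weight `|c|_A`; on circuits of `G(A)` all the entries involved are finite. -/
def weight (A : Matrix ι ι Rmin) (k : ℕ) (c : ℕ → ι) : ℝ :=
  ∑ m ∈ Finset.range k, (Tropical.untrop (A (c m) (c (m + 1)))).untopD 0

/-- `|c|_C`: the number of arcs of `c` with initial node in `C`. -/
def visits (C : Finset ι) (k : ℕ) (c : ℕ → ι) : ℕ :=
  ((Finset.range k).filter (fun m => c m ∈ C)).card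

/-- The min-plus eigenvalue of an irreducible matrix: the minimal circuit mean. -/
def rhoMin (A : Matrix ι ι Rmin) : ℝ :=
  sInf {x | ∃ k c, IsCircuit (arcs A) k c ∧ x = weight A k c / k}

/-- The circuits of `G(A)` that attain the minimal circuit mean. -/
def IsCriticalCircuit (A : Matrix ι ι Rmin) (k : ℕ) (c : ℕ → ι) : Prop :=
  IsCircuit (arcs A) k c ∧ weight A k c / k = rhoMin A

/-- The arcs that belong to a circuit of the family `S`. -/
def arcsOf (S : ℕ → (ℕ → ι) → Prop) (i j : ι) : Prop :=
  ∃ k c, S k c ∧ ∃ m < k, c m = i ∧ c (m + 1) = j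

open Classical in
/-- The nodes that belong to a circuit of the family `S`. -/
def nodesOf (S : ℕ → (ℕ → ι) → Prop) : Finset ι :=
  Finset.univ.filter (fun i => ∃ k c, S k c ∧ ∃ m < k, c m = i)

/-- The arcs of the critical graph `G^c(A)`. -/
def critArcs (A : Matrix ι ι Rmin) : ι → ι → Prop := arcsOf (IsCriticalCircuit A)

/-- The nodes of the critical graph `G^c(A)`. -/
def critNodes (A : Matrix ι ι Rmin) : Finset ι := nodesOf (IsCriticalCircuit A)

/-- The graph with node set `W` and arc relation `R` has a disjoint circuit cover: some
circuits `c 0, …, c (q - 1)` of the graph, which are elementary and pairwise disjoint,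
contain all the nodes. -/
def HasDisjointCircuitCover (W : Finset ι) (R : ι → ι → Prop) : Prop :=
  ∃ (q : ℕ) (len : Fin q → ℕ) (c : Fin q → ℕ → ι),
    (∀ s, IsCircuit R (len s) (c s)) ∧
    (∀ s t, ∀ m < len s, ∀ p < len t, c s m = c t p → s = t ∧ m = p) ∧
    ∀ i ∈ W, ∃ s, ∃ m < len s, c s m = i

/-- The arcs of the saturation graph of `A` and `V`. -/
def satArcs (A : Matrix ι ι Rmin) (V : ι → Rmin) (i j : ι) : Prop :=
  A.mulVec V i = A i j * V j

/-- `V` is an eigenvector of `A`. -/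
def IsEigenvector (A : Matrix ι ι Rmin) (V : ι → Rmin) : Prop :=
  V ≠ 0 ∧ ∃ x : Rmin, A.mulVec V = x • V

/-! ### Min-plus Schur complements

A matrix indexed by a subset of `ι` is extended to an `ι × ι` matrix by the min-plus zero `+∞`.
The nodes outside of the subset are then isolated and belong to no circuit. -/

/-- The block `A_{JK}`, extended by `+∞`. -/
def block (A : Matrix ι ι Rmin) (J K : Finset ι) : Matrix ι ι Rmin :=
  Matrix.of fun i j => if i ∈ J ∧ j ∈ K then A i j else 0

/-- The Kleene star: the entrywise infimum of the powers of `A`. (It is used only for matrices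
without circuits of negative weight, for which these infima are not `-∞`.) -/
def kleeneStar (A : Matrix ι ι Rmin) : Matrix ι ι Rmin :=
  Matrix.of fun i j => Tropical.trop (⨅ k : ℕ, Tropical.untrop ((A ^ k) i j))

/-- The min-plus Schur complement
`Schur(C, x, A) = A_{NN} ⊕ A_{NC} (x⁻¹ A_{CC})^* x⁻¹ A_{CN}`, where `N` is the complement
of `C`. -/
def minSchur (C : Finset ι) (x : ℝ) (A : Matrix ι ι Rmin) : Matrix ι ι Rmin :=
  block A Cᶜ Cᶜ +
    block A Cᶜ C * kleeneStar (ofReal (-x) • block A C C) * (ofReal (-x) • block A C Cᶜ)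

/-! ### Critical values -/

/-- The matrices `A_ℓ`, `ℓ ≥ 1`: `A_1 = A` and `A_{ℓ+1} = Schur(C_ℓ, α_ℓ, A_ℓ)`, where
`α_ℓ = ρ_min(A_ℓ)` and `C_ℓ` is the set of critical nodes of `A_ℓ`.
(The value at `0` plays no role.) -/
def seqMat (A : Matrix ι ι Rmin) : ℕ → Matrix ι ι Rmin
  | 0 => A
  | 1 => A
  | l + 2 => minSchur (critNodes (seqMat A (l + 1))) (rhoMin (seqMat A (l + 1))) (seqMat A (l + 1))

/-- The critical values `α_ℓ`, `ℓ ≥ 1`. -/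
def critVal (A : Matrix ι ι Rmin) (l : ℕ) : ℝ := rhoMin (seqMat A l)

/-- The sets `C_ℓ`, `ℓ ≥ 1`, completed by `C_0 = ∅`. -/
def critSet (A : Matrix ι ι Rmin) (l : ℕ) : Finset ι :=
  if l = 0 then ∅ else critNodes (seqMat A l)

/-- The sets `C^ℓ = C_1 ∪ ⋯ ∪ C_ℓ`. -/
def cumSet (A : Matrix ι ι Rmin) (l : ℕ) : Finset ι := (Finset.Icc 1 l).biUnion (critSet A)

/-- The number `k` of critical values: the first index with `C^k = ι`. -/
def numCrit (A : Matrix ι ι Rmin) : ℕ := sInf {l | cumSet A l = Finset.univ}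

/-- `|c|^ℓ_A`. -/
def weightOrd (A : Matrix ι ι Rmin) (l k : ℕ) (c : ℕ → ι) : ℝ :=
  weight A k c - ∑ m ∈ Finset.Ico 1 l, critVal A m * visits (critSet A m) k c

/-- `|c|^ℓ`. -/
def lengthOrd (A : Matrix ι ι Rmin) (l k : ℕ) (c : ℕ → ι) : ℝ :=
  (k : ℝ) - ∑ m ∈ Finset.Ico 1 l, (visits (critSet A m) k c : ℝ)

/-- Critical circuits of order `ℓ ≥ 1`; there are none of order `0`, so that the critical graph
of order `0` is empty. -/
def IsCriticalCircuitOfOrder (A : Matrix ι ι Rmin) (l k : ℕ) (c : ℕ → ι) : Prop :=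
  1 ≤ l ∧ IsCircuit (arcs A) k c ∧ weightOrd A l k c = critVal A l * lengthOrd A l k c

/-- The critical graph of order `ℓ`, `G^c_ℓ(A)`, has a disjoint circuit cover. -/
def CritGraphHasCover (A : Matrix ι ι Rmin) (l : ℕ) : Prop :=
  HasDisjointCircuitCover (nodesOf (IsCriticalCircuitOfOrder A l))
    (arcsOf (IsCriticalCircuitOfOrder A l))

/-- The diagonal of `D = D_k`: it is `α_m` at the nodes of `C_m` for `m < k`, and `α_k` at the
other nodes. -/
def diagD (A : Matrix ι ι Rmin) (j : ι) : ℝ :=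
  if j ∈ cumSet A (numCrit A - 1) then critVal A (sInf {m | j ∈ critSet A m})
  else critVal A (numCrit A)

/-- `Â = D⁻¹ A`. -/
def hatMat (A : Matrix ι ι Rmin) : Matrix ι ι Rmin :=
  Matrix.diagonal (fun i => ofReal (-diagD A i)) * A

/-- `G` is the critical graph of `Â`, or the saturation graph of `Â` and one of its
eigenvectors. -/
def IsAdmissibleGraph (A : Matrix ι ι Rmin) (G : ι → ι → Prop) : Prop :=
  G = critArcs (hatMat A) ∨ ∃ V, IsEigenvector (hatMat A) V ∧ G = satArcs (hatMat A) V

/-! ### Conventional Schur complements -/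

/-- The conventional Schur complement `b_{NN} - b_{NC} (b_{CC})⁻¹ b_{CN}`, where `N` is the
complement of `C`; it is meaningful when `b_{CC}` is invertible. -/
def schur (C : Finset ι) (b : Matrix ι ι ℂ) : Matrix {i // i ∉ C} {i // i ∉ C} ℂ :=
  b.toBlock (· ∉ C) (· ∉ C) -
    b.toBlock (· ∉ C) (· ∈ C) * (b.toBlock (· ∈ C) (· ∈ C))⁻¹ * b.toBlock (· ∈ C) (· ∉ C)

open Classical in
/-- The matrix `b^G`. -/
def maskMat (G : ι → ι → Prop) (b : Matrix ι ι ℂ) : Matrix ι ι ℂ :=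
  Matrix.of fun i j => if G i j then b i j else 0

/-- `r^ℓ`: the `C^{ℓ-1} × C^{ℓ-1}` block of `a^G`. -/
def rMat (A : Matrix ι ι Rmin) (G : ι → ι → Prop) (a : Matrix ι ι ℂ) (l : ℕ) :
    Matrix {i // i ∈ cumSet A (l - 1)} {i // i ∈ cumSet A (l - 1)} ℂ :=
  (maskMat G a).toBlock (· ∈ cumSet A (l - 1)) (· ∈ cumSet A (l - 1))

/-- `s^ℓ`: the Schur complement of `C^{ℓ-1}` in `a^G` (for `ℓ = 1` this is `a^G`). -/
def sMat (A : Matrix ι ι Rmin) (G : ι → ι → Prop) (a : Matrix ι ι ℂ) (l : ℕ) :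
    Matrix {i // i ∉ cumSet A (l - 1)} {i // i ∉ cumSet A (l - 1)} ℂ :=
  schur (cumSet A (l - 1)) (maskMat G a)

/-- `t^ℓ`: the `C_ℓ × C_ℓ` block of `s^ℓ`. -/
def tMat (A : Matrix ι ι Rmin) (G : ι → ι → Prop) (a : Matrix ι ι ℂ) (l : ℕ) :
    Matrix {i : {i // i ∉ cumSet A (l - 1)} // i.1 ∈ critSet A l}
      {i : {i // i ∉ cumSet A (l - 1)} // i.1 ∈ critSet A l} ℂ :=
  (sMat A G a l).toBlock (fun i => i.1 ∈ critSet A l) (fun i => i.1 ∈ critSet A l)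

/-! ### Germs, asymptotics, eigenvalues, genericity -/

/-- `f` represents a germ of the ring `𝒞`: on some interval `(0, ε₀)` it is continuous and
bounded by a power `ε^(-k)`. -/
def IsGerm (f : ℝ → ℂ) : Prop :=
  ∃ e₀ > 0, ContinuousOn f (Set.Ioo 0 e₀) ∧
    ∃ k : ℝ, 0 < k ∧ ∀ e ∈ Set.Ioo (0 : ℝ) e₀, ‖f e‖ ≤ e ^ (-k)

/-- `f(ε) = z ε^x + o(ε^x)` as `ε → 0⁺`, for a real exponent `x`. -/
def HasAsymp (f : ℝ → ℂ) (z : ℂ) (x : ℝ) : Prop :=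
  Tendsto (fun e : ℝ => ((e ^ (-x) : ℝ) : ℂ) * f e) (𝓝[>] 0) (𝓝 z)

/-- `f(ε) ≃ z ε^X` for an exponent `X` in `ℝ ∪ {+∞}`; for `X = +∞` it means that `f` vanishes
near `0`. -/
def Simeq (f : ℝ → ℂ) (z : ℂ) (X : Rmin) : Prop :=
  (X = 0 → ∀ᶠ e in 𝓝[>] (0 : ℝ), f e = 0) ∧ ∀ x : ℝ, X = ofReal x → HasAsymp f z x

/-- `f(ε) ∼ z ε^x` for some non-zero `z`. -/
def HasEquivalent (f : ℝ → ℂ) (x : ℝ) : Prop := ∃ z : ℂ, z ≠ 0 ∧ HasAsymp f z x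

/-- `|f(ε)| ε^(-x) → +∞`. -/
def IsOmega (f : ℝ → ℂ) (x : ℝ) : Prop :=
  Tendsto (fun e : ℝ => e ^ (-x) * ‖f e‖) (𝓝[>] 0) atTop

/-- For all small `ε > 0`, the `Y i ε` are the eigenvalues of `M ε`, counted with
multiplicities. -/
def EnumeratesEigenvalues (M : ℝ → Matrix ι ι ℂ) (Y : ι → ℝ → ℂ) : Prop :=
  ∀ᶠ e in 𝓝[>] (0 : ℝ), (M e).charpoly.roots = Finset.univ.val.map (fun i => Y i e)

/-- The number of eigenvalues of `M ε` that have an equivalent of the form `z ε^x`, `z ≠ 0`,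
is `m`: the eigenvalues can be enumerated so that exactly `m` of them have such an equivalent
and any other one is `o(ε^x)` or `ω(ε^x)`; and any enumeration of the eigenvalues
by germs of `𝒞` has exactly `m` members with such an equivalent. -/
def EquivalentCount (M : ℝ → Matrix ι ι ℂ) (x : ℝ) (m : ℕ) : Prop :=
  (∃ Y : ι → ℝ → ℂ, EnumeratesEigenvalues M Y ∧ {i | HasEquivalent (Y i) x}.ncard = m ∧
    ∀ i, HasEquivalent (Y i) x ∨ HasAsymp (Y i) 0 x ∨ IsOmega (Y i) x) ∧
  ∀ Y : ι → ℝ → ℂ, (∀ i, IsGerm (Y i)) → EnumeratesEigenvalues M Y →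
    {i | HasEquivalent (Y i) x}.ncard = m

/-- `P a` holds for generic values of the complex matrix `a`: there is a non-zero polynomial in
the entries which vanishes at every `a` such that `P a` is false. -/
def Generically (P : Matrix ι ι ℂ → Prop) : Prop :=
  ∃ Q : MvPolynomial (ι × ι) ℂ, Q ≠ 0 ∧
    ∀ a : Matrix ι ι ℂ, ¬ P a → MvPolynomial.eval (fun p => a p.1 p.2) Q = 0

end MinPlus

end

set_option linter.unusedSectionVars false

namespace MinPlus

variable {ι : Type} [Fintype ι] [DecidableEq ι] {A B : Matrix ι ι Rmin}

/-! ### The min-plus semiring -/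

/-! Everything is read on walks, recorded by their weight and by the vector `μ` counting the visits
of their nodes, the last one excepted. A finite entry of a min-plus Schur complement is a walk
between nodes of `N` whose intermediate nodes lie in `C`, each departure from a node of `C` being
charged `λ`. Iterating, the walks of `A_ℓ` are the walks of `A` between nodes outside `C^{ℓ-1}`,
with `α_m` subtracted at each visit of `C_m`, up to a decrease of the weight (`IsReduced`).

Let `D_ℓ` have diagonal entry `d_i = α_m` on `C_m` for `m < ℓ` and `α_ℓ` elsewhere (`ordVal`). As
`α_ℓ` is the minimal circuit mean of `A_ℓ`, the circuits of `D_ℓ⁻¹ A` have non-negative weight,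
those of weight zero stay in `C^ℓ`, and each node of `C^ℓ` is on one of them (`circuit_bound`,
`exists_tight_circuit`). These zero-weight circuits are the critical circuits of order `ℓ`; they
remain critical for larger orders.

A disjoint circuit cover of the critical graph of order `ℓ` is a permutation of `C^ℓ` along its
arcs. If `G` contains these arcs, the `C^ℓ` block of `a^G` is thus generically invertible, and so is
the `C^{ℓ-1}` block `r`; the former has determinant `det r * det t`, so `t` is generically
invertible too. Admissible graphs do contain these arcs, which gives the first claim.

For the second one, take a potential `v`, that is `d_i + v_i ≤ A_ij + v_j`, and let `G` be the graph
of the equality arcs. Multiply row `i` of `ε^{α_ℓ} z - M_ε` by `ε^{-d_i-v_i}` and column `j` by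
`ε^{v_j}`. Since `d_i < α_ℓ` on `C^{ℓ-1}`, the limit is `diag(0 on C^{ℓ-1}, z elsewhere) - a^G`.
Circuits of `G` have weight zero for `D_ℓ⁻¹ A`, hence stay in `C^ℓ`, and the limit determinant is
`det(-r) z^{n-|C^ℓ|} χ_t(z)` (`det_pencil`). With `t` invertible it has exactly `|C_ℓ|` non-zero
roots. The rescaled eigenvalues converge to its roots or to infinity, which is handled in the
Riemann sphere (`equivalentCount_of_tendsto`). -/

theorem ofReal_ne_zero (x : ℝ) : ofReal x ≠ 0 := Tropical.trop_coe_ne_zero x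

theorem ofReal_mul (x y : ℝ) : ofReal x * ofReal y = ofReal (x + y) := rfl

theorem ofReal_le_ofReal {x y : ℝ} : ofReal x ≤ ofReal y ↔ x ≤ y :=
  WithTop.coe_le_coe

theorem ofReal_inj {x y : ℝ} : ofReal x = ofReal y ↔ x = y :=
  ⟨fun h => le_antisymm (ofReal_le_ofReal.1 h.le) (ofReal_le_ofReal.1 h.ge), fun h => h ▸ rfl⟩

theorem exists_ofReal_of_ne_zero {X : Rmin} (h : X ≠ 0) : ∃ x, X = ofReal x := by
  have h' : Tropical.untrop X ≠ ⊤ := fun h' => h (Tropical.untrop_injective h')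
  obtain ⟨x, hx⟩ := WithTop.ne_top_iff_exists.1 h'
  exact ⟨x, Tropical.untrop_injective hx.symm⟩

theorem exists_ofReal_of_le {X : Rmin} {y : ℝ} (h : X ≤ ofReal y) : ∃ x, X = ofReal x ∧ x ≤ y := by
  obtain ⟨x, rfl⟩ := exists_ofReal_of_ne_zero (X := X) (by
    rintro rfl
    exact ofReal_ne_zero y (le_antisymm (Tropical.le_zero _) h))
  exact ⟨x, rfl, ofReal_le_ofReal.1 h⟩

theorem mul_eq_ofReal {X Y : Rmin} {z : ℝ} (h : X * Y = ofReal z) :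
    ∃ x y, X = ofReal x ∧ Y = ofReal y ∧ z = x + y := by
  have hX : X ≠ 0 := by rintro rfl; exact ofReal_ne_zero z (by rw [← h, zero_mul])
  have hY : Y ≠ 0 := by rintro rfl; exact ofReal_ne_zero z (by rw [← h, mul_zero])
  obtain ⟨x, rfl⟩ := exists_ofReal_of_ne_zero hX
  obtain ⟨y, rfl⟩ := exists_ofReal_of_ne_zero hY
  exact ⟨x, y, rfl, rfl, (ofReal_inj.1 h).symm⟩

theorem add_le_left (X Y : Rmin) : X + Y ≤ X := min_le_left _ _

theorem add_le_right (X Y : Rmin) : X + Y ≤ Y := min_le_right _ _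

theorem sum_le_of_mem {κ : Type*} (s : Finset κ) (f : κ → Rmin) {i : κ} (hi : i ∈ s) :
    ∑ j ∈ s, f j ≤ f i := by
  classical
  rw [← Finset.add_sum_erase _ _ hi]
  exact add_le_left _ _

theorem exists_eq_of_sum_eq_ofReal {κ : Type*} (s : Finset κ) (f : κ → Rmin) {x : ℝ}
    (h : ∑ j ∈ s, f j = ofReal x) : ∃ i ∈ s, f i = ofReal x := by
  classical
  induction s using Finset.induction_on with
  | empty => exact absurd h.symm (ofReal_ne_zero x)
  | insert a s ha ih =>
    rw [Finset.sum_insert ha, Tropical.add_eq_iff] at h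
    rcases h with ⟨h, -⟩ | ⟨h, -⟩
    · exact ⟨a, Finset.mem_insert_self _ _, h⟩
    · obtain ⟨i, hi, h⟩ := ih h
      exact ⟨i, Finset.mem_insert_of_mem hi, h⟩

theorem mul_apply_le (A B : Matrix ι ι Rmin) (i j k : ι) : (A * B) i k ≤ A i j * B j k := by
  rw [Matrix.mul_apply]
  exact sum_le_of_mem Finset.univ (fun j => A i j * B j k) (Finset.mem_univ j)

theorem mul_apply_eq_ofReal {A B : Matrix ι ι Rmin} {i k : ι} {z : ℝ}
    (h : (A * B) i k = ofReal z) :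
    ∃ j x y, A i j = ofReal x ∧ B j k = ofReal y ∧ z = x + y := by
  rw [Matrix.mul_apply] at h
  obtain ⟨j, -, hj⟩ := exists_eq_of_sum_eq_ofReal _ _ h
  exact ⟨j, mul_eq_ofReal hj⟩

/-! ### Walks -/

/-- There is a walk from `i` to `j` in `G(B)` of weight `x` whose nodes, the last one excepted,
are counted by `μ`. -/
inductive IsWalk (B : Matrix ι ι Rmin) : ι → ι → ℝ → (ι → ℕ) → Prop
  | nil (i : ι) : IsWalk B i i 0 0
  | cons {i j k : ι} {x y : ℝ} {μ : ι → ℕ} (h : B i j = ofReal x) (t : IsWalk B j k y μ) :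
      IsWalk B i k (x + y) (Pi.single i 1 + μ)

theorem IsWalk.single {i j : ι} {x : ℝ} (h : B i j = ofReal x) :
    IsWalk B i j x (Pi.single i 1) := by
  simpa using IsWalk.cons h (IsWalk.nil j)

theorem IsWalk.append {i j k : ι} {x y : ℝ} {μ ν : ι → ℕ} (h : IsWalk B i j x μ)
    (h' : IsWalk B j k y ν) : IsWalk B i k (x + y) (μ + ν) := by
  induction h with
  | nil i => simpa using h'
  | cons h t ih =>
    rw [add_assoc, add_assoc]
    exact IsWalk.cons h (ih h')

/-- The cut is made at a visit counted by `μ`, so the second piece is not empty. This makes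
inductions on the length decrease. -/
theorem IsWalk.split {i k : ι} {x : ℝ} {μ : ι → ℕ} (h : IsWalk B i k x μ) {j : ι}
    (hj : 0 < μ j) : ∃ x₁ x₂ μ₁ μ₂, IsWalk B i j x₁ μ₁ ∧ IsWalk B j k x₂ μ₂ ∧ x = x₁ + x₂ ∧
      μ = μ₁ + μ₂ ∧ 0 < μ₂ j := by
  induction h with
  | nil i => simp at hj
  | @cons i l k x y μ h t ih =>
    by_cases hij : i = j
    · subst hij
      exact ⟨0, _, 0, _, .nil _, .cons h t, by simp, by simp, by simp⟩
    · obtain ⟨x₁, x₂, μ₁, μ₂, h₁, h₂, rfl, rfl, hp⟩ :=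
        ih (by simpa [Pi.single_apply, Ne.symm hij] using hj)
      exact ⟨x + x₁, x₂, _, μ₂, .cons h h₁, h₂, by ring, by rw [add_assoc], hp⟩

theorem IsWalk.pos_start {i k : ι} {x : ℝ} {μ : ι → ℕ} (h : IsWalk B i k x μ) (hμ : μ ≠ 0) :
    0 < μ i := by
  cases h with
  | nil => exact absurd rfl hμ
  | cons h t => simp

theorem IsWalk.eq_of_zero {i k : ι} {x : ℝ} (h : IsWalk B i k x 0) : i = k ∧ x = 0 := by
  generalize hμ : (0 : ι → ℕ) = μ at h
  cases h with
  | nil => simp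
  | cons h t =>
    have := congrFun hμ i
    simp at this
    omega

/-- A closed walk can start at any of its nodes. -/
theorem IsWalk.rotate {i : ι} {x : ℝ} {μ : ι → ℕ} (h : IsWalk B i i x μ) {j : ι}
    (hj : 0 < μ j) : IsWalk B j j x μ := by
  obtain ⟨x₁, x₂, μ₁, μ₂, h₁, h₂, rfl, rfl, -⟩ := h.split hj
  rw [add_comm x₁, add_comm μ₁]
  exact h₂.append h₁

/-- Conjugation by a diagonal: the weight is shifted by the visits. -/
theorem IsWalk.shift {B' : Matrix ι ι Rmin} (d : ι → ℝ)
    (hB : ∀ i j, B' i j = ofReal (d i) * B i j) {i j : ι} {x : ℝ} {μ : ι → ℕ}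
    (h : IsWalk B i j x μ) : IsWalk B' i j (x + ∑ k, μ k * d k) μ := by
  induction h with
  | nil i => simpa using IsWalk.nil (B := B') i
  | @cons i j k x y μ h t ih =>
    have := IsWalk.cons (by rw [hB, h, ofReal_mul] : B' i j = ofReal (d i + x)) ih
    convert this using 1
    simp [add_mul, Finset.sum_add_distrib, Pi.single_apply]
    ring

theorem IsWalk.pow_le {i j : ι} {x : ℝ} {μ : ι → ℕ} (h : IsWalk B i j x μ) :
    (B ^ (∑ k, μ k)) i j ≤ ofReal x := by
  induction h with
  | nil i => simpa using (show (1 : Rmin) ≤ ofReal 0 from le_rfl)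
  | @cons i j k x y μ h t ih =>
    simp only [Pi.add_apply, Finset.sum_add_distrib, Finset.sum_pi_single', Finset.mem_univ, if_true]
    rw [pow_add, pow_one, ← ofReal_mul]
    refine (mul_apply_le _ _ i j k).trans ?_
    rw [h]
    exact mul_le_mul_right ih _

theorem exists_isWalk_of_pow {k : ℕ} {i j : ι} {x : ℝ} (h : (B ^ k) i j = ofReal x) :
    ∃ μ, IsWalk B i j x μ ∧ ∑ l, μ l = k := by
  induction k generalizing i x with
  | zero =>
    rw [pow_zero, Matrix.one_apply] at h
    split_ifs at h with hij
    · subst hij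
      obtain rfl : 0 = x := ofReal_inj.1 h
      exact ⟨0, .nil _, by simp⟩
    · exact absurd h.symm (ofReal_ne_zero x)
  | succ k ih =>
    rw [pow_succ'] at h
    obtain ⟨l, y, z, hy, hz, rfl⟩ := mul_apply_eq_ofReal h
    obtain ⟨μ, hμ, rfl⟩ := ih hz
    exact ⟨_, .cons hy hμ, by simp [Finset.sum_add_distrib, add_comm]⟩

theorem exists_isWalk_of_transGen {i j : ι} (h : Relation.TransGen (arcs B) i j) :
    ∃ x μ, IsWalk B i j x μ ∧ μ ≠ 0 := by
  induction h with
  | single h =>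
    obtain ⟨x, hx⟩ := exists_ofReal_of_ne_zero h
    exact ⟨x, _, .single hx, by simp⟩
  | tail _ h ih =>
    obtain ⟨x, μ, hμ, h0⟩ := ih
    obtain ⟨y, hy⟩ := exists_ofReal_of_ne_zero h
    exact ⟨_, _, hμ.append (.single hy), fun h => h0 (funext fun k => by
      have := congrFun h k
      simp only [Pi.add_apply, Pi.zero_apply] at this ⊢
      omega)⟩

/-! ### Walks and circuits -/

/-- The number of visits of the nodes by the sequence `c`. -/
def visitCount (k : ℕ) (c : ℕ → ι) (i : ι) : ℕ := ((Finset.range k).filter (fun m => c m = i)).card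

theorem sum_visitCount (k : ℕ) (c : ℕ → ι) (f : ι → ℝ) :
    ∑ i, visitCount k c i * f i = ∑ m ∈ Finset.range k, f (c m) := by
  rw [← Finset.sum_fiberwise (Finset.range k) c]
  refine Finset.sum_congr rfl fun i _ => ?_
  rw [Finset.sum_congr rfl (fun m hm => by rw [(Finset.mem_filter.1 hm).2]), Finset.sum_const,
    nsmul_eq_mul, visitCount]

theorem visitCount_pos {k : ℕ} {c : ℕ → ι} {i : ι} : 0 < visitCount k c i ↔ ∃ m < k, c m = i := by
  simp [visitCount, Finset.card_pos, Finset.Nonempty]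

theorem visitCount_succ (k : ℕ) (c : ℕ → ι) :
    visitCount (k + 1) c = Pi.single (c 0) 1 + visitCount k (fun m => c (m + 1)) := by
  funext i
  simp only [visitCount, Finset.card_filter, Finset.sum_range_succ', Pi.add_apply, Pi.single_apply]
  rw [add_comm]
  simp [eq_comm]

theorem weight_succ (A : Matrix ι ι Rmin) (k : ℕ) (c : ℕ → ι) :
    weight A (k + 1) c = (Tropical.untrop (A (c 0) (c 1))).untopD 0
      + weight A k (fun m => c (m + 1)) := by
  simp [weight, Finset.sum_range_succ', add_comm]

theorem isWalk_of_seq (k : ℕ) (c : ℕ → ι) (h : ∀ m < k, arcs B (c m) (c (m + 1))) :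
    IsWalk B (c 0) (c k) (weight B k c) (visitCount k c) := by
  induction k generalizing c with
  | zero =>
    have h1 : weight B 0 c = 0 := by simp [weight]
    have h2 : visitCount 0 c = 0 := by funext i; simp [visitCount]
    rw [h1, h2]
    exact .nil _
  | succ k ih =>
    rw [weight_succ, visitCount_succ]
    refine .cons (j := c 1) ?_ (ih (fun m => c (m + 1)) fun m hm => h (m + 1) (by omega))
    obtain ⟨x, hx⟩ := exists_ofReal_of_ne_zero (h 0 (by omega))
    rw [zero_add] at hx
    rw [hx]
    rfl

theorem IsWalk.exists_seq {i j : ι} {x : ℝ} {μ : ι → ℕ} (h : IsWalk B i j x μ) :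
    ∃ (k : ℕ) (c : ℕ → ι), c 0 = i ∧ c k = j ∧ (∀ m < k, arcs B (c m) (c (m + 1))) ∧
      weight B k c = x ∧ visitCount k c = μ := by
  induction h with
  | nil i => exact ⟨0, fun _ => i, rfl, rfl, by simp, by simp [weight], by funext; simp [visitCount]⟩
  | @cons i j l x y μ h t ih =>
    obtain ⟨k, c, rfl, rfl, hc, rfl, rfl⟩ := ih
    refine ⟨k + 1, fun m => Nat.casesOn m i c, rfl, rfl, ?_, ?_, ?_⟩
    · rintro (_ | m) hm
      · show B i (c 0) ≠ 0
        rw [h]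
        exact ofReal_ne_zero x
      · exact hc m (by omega)
    · rw [weight_succ]
      show (Tropical.untrop (B i (c 0))).untopD 0 + _ = _
      rw [h]
      rfl
    · exact visitCount_succ _ _

theorem IsCircuit.isWalk {k : ℕ} {c : ℕ → ι} (h : IsCircuit (arcs B) k c) :
    IsWalk B (c 0) (c 0) (weight B k c) (visitCount k c) := by
  have := isWalk_of_seq k c h.2.2
  rwa [h.2.1] at this

theorem IsWalk.exists_circuit {i : ι} {x : ℝ} {μ : ι → ℕ} (h : IsWalk B i i x μ) (hμ : μ ≠ 0) :
    ∃ k c, IsCircuit (arcs B) k c ∧ weight B k c = x ∧ visitCount k c = μ := by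
  obtain ⟨k, c, h0, hk, hc, hx, rfl⟩ := h.exists_seq
  refine ⟨k, c, ⟨Nat.pos_of_ne_zero ?_, by rw [h0, hk], hc⟩, hx, rfl⟩
  rintro rfl
  exact hμ (by funext; simp [visitCount])

theorem sum_visitCount_nat (k : ℕ) (c : ℕ → ι) : ∑ i, visitCount k c i = k := by
  have := sum_visitCount k c (fun _ => 1)
  simp only [mul_one, Finset.sum_const, Finset.card_range, nsmul_eq_mul] at this
  exact_mod_cast this

theorem visitCount_ne_zero {k : ℕ} (hk : 0 < k) (c : ℕ → ι) : visitCount k c ≠ 0 := by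
  intro h
  have := sum_visitCount_nat k c
  simp [h] at this
  omega

theorem visits_eq_sum (C : Finset ι) (k : ℕ) (c : ℕ → ι) :
    (visits C k c : ℝ) = ∑ i ∈ C, (visitCount k c i : ℝ) := by
  have := sum_visitCount k c (fun i => if i ∈ C then 1 else 0)
  simp only [mul_ite, mul_one, mul_zero, Finset.sum_ite_mem, Finset.univ_inter] at this
  rw [this, visits, Finset.card_filter]
  push_cast
  rfl

/-! ### Shortening walks -/

/-- When the first node recurs in the already shortened tail, the closed piece before its recurrence
has non-negative weight and is dropped. -/
theorem IsWalk.exists_simple (hB : ∀ i x μ, IsWalk B i i x μ → 0 ≤ x) {i j : ι} {x : ℝ}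
    {μ : ι → ℕ} (h : IsWalk B i j x μ) :
    ∃ x' ≤ x, ∃ μ', IsWalk B i j x' μ' ∧ ∀ k, μ' k ≤ 1 := by
  induction h with
  | nil i => exact ⟨0, le_rfl, 0, .nil i, by simp⟩
  | @cons i j k x y μ h t ih =>
    obtain ⟨y', hy, μ', ht, hs⟩ := ih
    rcases Nat.eq_zero_or_pos (μ' i) with h0 | h0
    · refine ⟨x + y', by linarith, _, .cons h ht, fun l => ?_⟩
      by_cases hl : l = i
      · subst hl; simp [h0]
      · simpa [Pi.single_apply, hl] using hs l
    · obtain ⟨x₁, x₂, μ₁, μ₂, h₁, h₂, rfl, rfl, -⟩ := ht.split h0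
      have := hB _ _ _ (IsWalk.cons h h₁)
      exact ⟨x₂, by linarith, μ₂, h₂, fun l => le_trans (by simp) (hs l)⟩

theorem finite_walk_weights (B : Matrix ι ι Rmin) (k : ℕ) :
    {x | ∃ i j μ, IsWalk B i j x μ ∧ ∑ l, μ l = k}.Finite := by
  induction k with
  | zero =>
    refine (Set.finite_singleton (0 : ℝ)).subset ?_
    rintro x ⟨i, j, μ, h, hμ⟩
    have : μ = 0 := by funext l; simpa using (Finset.sum_eq_zero_iff.1 hμ) l
    subst this
    exact h.eq_of_zero.2
  | succ k ih =>
    have hf : (Set.range fun p : ι × ι => (Tropical.untrop (B p.1 p.2)).untopD 0).Finite :=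
      Set.finite_range _
    refine (Set.Finite.image2 (· + ·) hf ih).subset ?_
    rintro x ⟨i, j, μ, h, hμ⟩
    cases h with
    | nil => simp at hμ
    | @cons _ l _ x y μ h t =>
      refine ⟨x, ⟨(i, l), ?_⟩, y, ⟨l, j, μ, t, ?_⟩, rfl⟩
      · simp only [h]
        rfl
      · simp [Finset.sum_add_distrib] at hμ
        omega

/-- When there are no circuits of negative weight, the infima of the Kleene star are attained. -/
theorem kleeneStar_attained (hB : ∀ i x μ, IsWalk B i i x μ → 0 ≤ x) (i j : ι) :
    (∃ k, kleeneStar B i j = (B ^ k) i j) ∧ ∀ k, kleeneStar B i j ≤ (B ^ k) i j := by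
  -- A walk without repeated visits has at most `card ι` arcs, so finitely many powers suffice for
  -- the infimum.
  have key : ∀ k, ∃ m ∈ Finset.range (Fintype.card ι + 1), (B ^ m) i j ≤ (B ^ k) i j := by
    intro k
    by_cases h : (B ^ k) i j = 0
    · exact ⟨0, by simp, h ▸ Tropical.le_zero _⟩
    · obtain ⟨x, hx⟩ := exists_ofReal_of_ne_zero h
      obtain ⟨μ, hμ, -⟩ := exists_isWalk_of_pow hx
      obtain ⟨x', hx', μ', hw, hs⟩ := hμ.exists_simple hB
      refine ⟨∑ l, μ' l, ?_, hw.pow_le.trans (hx ▸ ofReal_le_ofReal.2 hx')⟩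
      have := Finset.sum_le_sum (fun l (_ : l ∈ Finset.univ) => hs l)
      simp at this
      simpa [Nat.lt_succ_iff] using this
  obtain ⟨m, -, hm⟩ := Finset.exists_min_image (Finset.range (Fintype.card ι + 1))
    (fun m => (B ^ m) i j) ⟨0, by simp⟩
  have hmin : ∀ k, (B ^ m) i j ≤ (B ^ k) i j := fun k => by
    obtain ⟨p, hp, hk⟩ := key k
    exact (hm p hp).trans hk
  have hst : kleeneStar B i j = (B ^ m) i j := by
    have : IsLeast (Set.range fun k : ℕ => Tropical.untrop ((B ^ k) i j))
        (Tropical.untrop ((B ^ m) i j)) :=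
      ⟨⟨m, rfl⟩, by rintro _ ⟨k, rfl⟩; exact hmin k⟩
    exact congrArg Tropical.trop this.csInf_eq
  exact ⟨⟨m, hst⟩, fun k => hst ▸ hmin k⟩

theorem kleeneStar_le_of_walk (hB : ∀ i x μ, IsWalk B i i x μ → 0 ≤ x) {i j : ι} {x : ℝ}
    {μ : ι → ℕ} (h : IsWalk B i j x μ) : kleeneStar B i j ≤ ofReal x :=
  ((kleeneStar_attained hB i j).2 _).trans h.pow_le

theorem exists_walk_of_kleeneStar (hB : ∀ i x μ, IsWalk B i i x μ → 0 ≤ x) {i j : ι} {x : ℝ}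
    (h : kleeneStar B i j = ofReal x) : ∃ μ, IsWalk B i j x μ := by
  obtain ⟨k, hk⟩ := (kleeneStar_attained hB i j).1
  obtain ⟨μ, hμ, -⟩ := exists_isWalk_of_pow (hk ▸ h)
  exact ⟨μ, hμ⟩

/-! ### The minimal circuit mean -/

/-- A closed walk longer than the number of nodes visits some node twice. Started at that node, it
is the concatenation of two shorter closed walks, and the bound is additive. -/
theorem closed_walk_weight_ge {r : ℝ}
    (hr : ∀ i x μ, IsWalk B i i x μ → ∑ l, μ l ≤ Fintype.card ι → r * ∑ l, (μ l : ℝ) ≤ x)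
    {i : ι} {x : ℝ} {μ : ι → ℕ} (h : IsWalk B i i x μ) : r * ∑ l, (μ l : ℝ) ≤ x := by
  induction hk : ∑ l, μ l using Nat.strong_induction_on generalizing i x μ with
  | _ k ih =>
    by_cases hle : ∑ l, μ l ≤ Fintype.card ι
    · exact hr _ _ _ h hle
    obtain ⟨j, -, hj⟩ : ∃ j ∈ Finset.univ, 1 < μ j := by
      by_contra! hcon
      apply hle
      simpa using Finset.sum_le_sum hcon
    have h' := h.rotate (j := j) (by omega)
    generalize hν : μ = ν at h'
    cases h' with
    | nil => simp [hν] at hj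
    | @cons _ l _ x y ν₀ hx t =>
      have hνj : 0 < ν₀ j := by
        simp [hν] at hj
        omega
      obtain ⟨x₁, x₂, μ₁, μ₂, h₁, h₂, rfl, rfl, hp⟩ := t.split hνj
      have hs : ∑ l, μ l = 1 + ∑ l, μ₁ l + ∑ l, μ₂ l := by
        simp [hν, Finset.sum_add_distrib, add_assoc]
      have hs2 : 0 < ∑ l, μ₂ l := hp.trans_le (Finset.single_le_sum (f := μ₂) (by simp) (Finset.mem_univ j))
      have e₁ := ih (∑ l, (Pi.single j 1 + μ₁ : ι → ℕ) l) (by simp [Finset.sum_add_distrib]; omega)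
        (IsWalk.cons hx h₁) rfl
      have e₂ := ih (∑ l, μ₂ l) (by omega) h₂ rfl
      have hs' : (∑ l, (μ l : ℝ)) = ∑ l, (((Pi.single j 1 + μ₁ : ι → ℕ) l : ℕ) : ℝ) + ∑ l, (μ₂ l : ℝ) := by
        rw [← Nat.cast_sum, hs]
        push_cast [Finset.sum_add_distrib]
        simp [Finset.sum_add_distrib, Pi.single_apply]
      rw [hν] at hs'
      rw [hs', mul_add]
      linarith

theorem sum_visits_pos {μ : ι → ℕ} (h : μ ≠ 0) : (0 : ℝ) < ∑ l, (μ l : ℝ) := by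
  obtain ⟨j, hj⟩ := Function.ne_iff.1 h
  exact_mod_cast (Nat.pos_of_ne_zero hj).trans_le
    (Finset.single_le_sum (f := μ) (by simp) (Finset.mem_univ j))

/-- If `G(B)` has a circuit, its minimal circuit mean is attained. -/
theorem rhoMin_spec (hB : ∃ i x μ, IsWalk B i i x μ ∧ μ ≠ 0) :
    (∀ i x μ, IsWalk B i i x μ → rhoMin B * ∑ l, (μ l : ℝ) ≤ x) ∧
      ∃ i μ, IsWalk B i i (rhoMin B * ∑ l, (μ l : ℝ)) μ ∧ μ ≠ 0 := by
  set T : ℕ → Set ℝ := fun k => {y | ∃ i x μ, IsWalk B i i x μ ∧ ∑ l, μ l = k ∧ μ ≠ 0 ∧ y = x / k}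
  have hTf : (⋃ k ∈ Finset.range (Fintype.card ι + 1), T k).Finite := by
    refine Set.Finite.biUnion (Finset.finite_toSet _) fun k _ => ?_
    refine ((finite_walk_weights B k).image (· / (k : ℝ))).subset ?_
    rintro y ⟨i, x, μ, h, hk, -, rfl⟩
    exact ⟨x, ⟨i, i, μ, h, hk⟩, rfl⟩
  have hge : ∀ r : ℝ, (∀ y ∈ ⋃ k ∈ Finset.range (Fintype.card ι + 1), T k, r ≤ y) →
      ∀ i x μ, IsWalk B i i x μ → r * ∑ l, (μ l : ℝ) ≤ x := by
    intro r hr i x μ h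
    refine closed_walk_weight_ge (fun i x μ h hle => ?_) h
    by_cases h0 : μ = 0
    · subst h0
      simp [h.eq_of_zero.2]
    · have := hr (x / (∑ l, μ l : ℕ)) (Set.mem_biUnion (x := ∑ l, μ l)
        (by simpa [Nat.lt_succ_iff] using hle) ⟨i, x, μ, h, rfl, h0, rfl⟩)
      rw [Nat.cast_sum] at this
      exact (le_div_iff₀ (sum_visits_pos h0)).1 this
  -- If there were no short circuit, every real number `r` would be a lower bound for the mean of
  -- the given circuit, including one above that mean.
  have hTne : (⋃ k ∈ Finset.range (Fintype.card ι + 1), T k).Nonempty := by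
    by_contra hne
    rw [Set.not_nonempty_iff_eq_empty] at hne
    obtain ⟨i, x, μ, h, h0⟩ := hB
    have := hge ((x + 1) / ∑ l, (μ l : ℝ)) (by rw [hne]; simp) i x μ h
    rw [div_mul_cancel₀ _ (sum_visits_pos h0).ne'] at this
    linarith
  obtain ⟨r, hrT, hr⟩ := Set.exists_min_image _ id hTf hTne
  have hlow := hge r hr
  simp only [Set.mem_iUnion] at hrT
  obtain ⟨k, -, i, x, μ, h, rfl, h0, hrx⟩ := hrT
  have hp := sum_visits_pos h0
  have hrho : rhoMin B = r := by
    refine IsLeast.csInf_eq ⟨?_, ?_⟩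
    · obtain ⟨k, c, hc, hw, hv⟩ := h.exists_circuit h0
      refine ⟨k, c, hc, ?_⟩
      rw [hrx, hw, ← hv, sum_visitCount_nat]
    · rintro _ ⟨k, c, hc, rfl⟩
      have hk : (0 : ℝ) < k := by exact_mod_cast hc.1
      have := hlow _ _ _ hc.isWalk
      rw [← Nat.cast_sum, sum_visitCount_nat] at this
      rwa [le_div_iff₀ hk]
  rw [hrho]
  refine ⟨hlow, i, μ, ?_, h0⟩
  have : x = r * ∑ l, (μ l : ℝ) := by
    rw [hrx]; push_cast
    rw [div_mul_cancel₀ _ hp.ne']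
  rwa [← this]

theorem mem_critNodes {i : ι} :
    i ∈ critNodes B ↔ ∃ μ, IsWalk B i i (rhoMin B * ∑ l, (μ l : ℝ)) μ ∧ 0 < μ i := by
  simp only [critNodes, nodesOf, Finset.mem_filter, Finset.mem_univ, true_and]
  constructor
  · rintro ⟨k, c, ⟨hc, hw⟩, hm⟩
    have hk : (0 : ℝ) < k := by exact_mod_cast hc.1
    have hp := visitCount_pos.2 hm
    refine ⟨visitCount k c, ?_, hp⟩
    rw [← Nat.cast_sum, sum_visitCount_nat, ← hw, div_mul_cancel₀ _ hk.ne']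
    exact hc.isWalk.rotate hp
  · rintro ⟨μ, h, hp⟩
    obtain ⟨k, c, hc, hw, rfl⟩ := h.exists_circuit (fun h => by simp [h] at hp)
    refine ⟨k, c, ⟨hc, ?_⟩, visitCount_pos.1 hp⟩
    have hk : (0 : ℝ) < k := by exact_mod_cast hc.1
    rw [hw, ← Nat.cast_sum, sum_visitCount_nat, mul_div_cancel_right₀ _ hk.ne']

/-! ### Walks of a Schur complement -/

theorem block_eq_ofReal {J K : Finset ι} {i j : ι} {x : ℝ} (h : block B J K i j = ofReal x) :
    i ∈ J ∧ j ∈ K ∧ B i j = ofReal x := by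
  simp only [block, Matrix.of_apply] at h
  split_ifs at h with hij
  · exact ⟨hij.1, hij.2, h⟩
  · exact absurd h.symm (ofReal_ne_zero x)

theorem block_apply {J K : Finset ι} {i j : ι} (hi : i ∈ J) (hj : j ∈ K) :
    block B J K i j = B i j := by simp [block, hi, hj]

theorem IsWalk.of_block {J K : Finset ι} {i j : ι} {x : ℝ} {μ : ι → ℕ}
    (h : IsWalk (block B J K) i j x μ) : IsWalk B i j x μ ∧ ∀ l ∉ J, μ l = 0 := by
  induction h with
  | nil i => exact ⟨.nil i, by simp⟩
  | @cons i j k x y μ h t ih =>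
    obtain ⟨hi, -, hx⟩ := block_eq_ofReal h
    refine ⟨.cons hx ih.1, fun l hl => ?_⟩
    have : l ≠ i := by rintro rfl; exact hl hi
    simp [this, ih.2 l hl]

/-- The entries of `x⁻¹ B_{CC}`. -/
theorem smul_block_walk {C : Finset ι} {r : ℝ} {i j : ι} {x : ℝ} {μ : ι → ℕ}
    (h : IsWalk (ofReal (-r) • block B C C) i j x μ) :
    IsWalk (block B C C) i j (x + r * ∑ l, (μ l : ℝ)) μ := by
  have := h.shift (B' := block B C C) (fun _ => r) (fun i j => by
    rw [Matrix.smul_apply, smul_eq_mul, ← mul_assoc, ofReal_mul, add_neg_cancel]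
    exact (one_mul _).symm)
  rwa [← Finset.sum_mul, mul_comm _ r] at this

section Schur

variable {C : Finset ι} {r : ℝ}

theorem star_nonneg (hC : ∀ i x μ, IsWalk B i i x μ → r * ∑ l, (μ l : ℝ) ≤ x) (i : ι) (x : ℝ)
    (μ : ι → ℕ) (h : IsWalk (ofReal (-r) • block B C C) i i x μ) : 0 ≤ x := by
  have := hC _ _ _ (smul_block_walk h).of_block.1
  linarith

theorem minSchur_apply (C : Finset ι) (r : ℝ) (B : Matrix ι ι Rmin) (i j : ι) :
    minSchur C r B i j = block B Cᶜ Cᶜ i j +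
      (block B Cᶜ C * (kleeneStar (ofReal (-r) • block B C C) *
        (ofReal (-r) • block B C Cᶜ))) i j := by
  rw [minSchur, Matrix.mul_assoc]
  rfl

theorem smul_block_eq_ofReal {J K : Finset ι} {i j : ι} {x : ℝ}
    (h : (ofReal (-r) • block B J K) i j = ofReal x) :
    i ∈ J ∧ j ∈ K ∧ B i j = ofReal (x + r) := by
  rw [Matrix.smul_apply, smul_eq_mul] at h
  obtain ⟨a, b, ha, hb, rfl⟩ := mul_eq_ofReal h
  have := ofReal_inj.1 ha
  rw [← this]
  simpa using block_eq_ofReal hb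

/-- Here `ν` counts the nodes of `C` on the excursion hidden in the entry. Each of them carries one
factor `r⁻¹`, either in the star or in the exit arc, and this is what `r * ∑ ν` restores. -/
theorem minSchur_arc_lift (hC : ∀ i x μ, IsWalk B i i x μ → r * ∑ l, (μ l : ℝ) ≤ x) {i j : ι}
    {x : ℝ} (h : minSchur C r B i j = ofReal x) :
    i ∉ C ∧ j ∉ C ∧ ∃ ν : ι → ℕ, IsWalk B i j (x + r * ∑ l, (ν l : ℝ)) (Pi.single i 1 + ν) ∧
      ∀ l ∉ C, ν l = 0 := by
  rw [minSchur_apply, Tropical.add_eq_iff] at h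
  rcases h with ⟨h, -⟩ | ⟨h, -⟩
  · obtain ⟨hi, hj, hx⟩ := block_eq_ofReal h
    exact ⟨by simpa using hi, by simpa using hj, 0, by simpa using IsWalk.single hx, by simp⟩
  · obtain ⟨p, a, b, ha, hb, rfl⟩ := mul_apply_eq_ofReal h
    obtain ⟨q, b, c, hb', hc, rfl⟩ := mul_apply_eq_ofReal hb
    obtain ⟨hi, hp, ha⟩ := block_eq_ofReal ha
    obtain ⟨hq, hj, hc⟩ := smul_block_eq_ofReal hc
    obtain ⟨ν, hν⟩ := exists_walk_of_kleeneStar (star_nonneg hC) hb'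
    obtain ⟨hw, hs⟩ := (smul_block_walk hν).of_block
    refine ⟨by simpa using hi, by simpa using hj, ν + Pi.single q 1, ?_, fun l hl => ?_⟩
    · convert IsWalk.cons ha (hw.append (.single hc)) using 1
      simp [Finset.sum_add_distrib, Pi.single_apply]
      ring
    · have : l ≠ q := by rintro rfl; exact hl hq
      simp [hs l hl, this]

/-- Walks of the Schur complement lift to walks of the matrix. -/
theorem minSchur_walk_lift (hC : ∀ i x μ, IsWalk B i i x μ → r * ∑ l, (μ l : ℝ) ≤ x) {i j : ι}
    {x : ℝ} {μ : ι → ℕ} (h : IsWalk (minSchur C r B) i j x μ) :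
    (∀ l ∈ C, μ l = 0) ∧ ∃ ν : ι → ℕ, IsWalk B i j (x + r * ∑ l, (ν l : ℝ)) (μ + ν) ∧
      ∀ l ∉ C, ν l = 0 := by
  induction h with
  | nil i => exact ⟨by simp, 0, by simpa using IsWalk.nil i, by simp⟩
  | @cons i j k x y μ h t ih =>
    obtain ⟨hi, -, ν, hν, hs⟩ := minSchur_arc_lift hC h
    obtain ⟨h0, ν', hν', hs'⟩ := ih
    refine ⟨fun l hl => ?_, ν + ν', ?_, fun l hl => by simp [hs l hl, hs' l hl]⟩
    · have : l ≠ i := by rintro rfl; exact hi hl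
      simp [this, h0 l hl]
    · convert hν.append hν' using 1
      · simp only [Pi.add_apply, Nat.cast_add, Finset.sum_add_distrib]
        ring
      · abel

/-- The induction removes the first arc, so it meets walks that start in the middle of an excursion
through `C`. For these, the second clause keeps the rest of the excursion, up to its exit node `k`,
as an entry of star times exit arc. An arc inside `C` is absorbed by the star, and an arc entering
`C` turns the excursion into one arc of the Schur complement. -/
theorem exists_walk_minSchur_aux (hC : ∀ i x μ, IsWalk B i i x μ → r * ∑ l, (μ l : ℝ) ≤ x)
    {i j : ι} {x : ℝ} {μ : ι → ℕ} (h : IsWalk B i j x μ) (hj : j ∉ C) :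
    (i ∉ C → ∃ y ≤ x - r * ∑ l ∈ C, (μ l : ℝ),
      IsWalk (minSchur C r B) i j y (fun l => if l ∈ C then 0 else μ l)) ∧
    (i ∈ C → ∃ k y z, k ∉ C ∧ (kleeneStar (ofReal (-r) • block B C C) *
        (ofReal (-r) • block B C Cᶜ)) i k = ofReal y ∧ y + z ≤ x - r * ∑ l ∈ C, (μ l : ℝ) ∧
      IsWalk (minSchur C r B) k j z (fun l => if l ∈ C then 0 else μ l)) := by
  have hM := star_nonneg (C := C) hC
  induction h with
  | nil i =>
    refine ⟨fun _ => ⟨0, by simp, ?_⟩, fun h => absurd h hj⟩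
    convert IsWalk.nil (B := minSchur C r B) i using 1
    funext l; simp
  | @cons i k j x y μ h t ih =>
    obtain ⟨ih₁, ih₂⟩ := ih hj
    have hsum : ∑ l ∈ C, (((Pi.single i 1 + μ : ι → ℕ) l : ℕ) : ℝ) =
        (if i ∈ C then 1 else 0) + ∑ l ∈ C, (μ l : ℝ) := by
      simp [Finset.sum_add_distrib, Pi.single_apply]
    have hrestN : i ∉ C → (fun l => if l ∈ C then 0 else (Pi.single i 1 + μ : ι → ℕ) l) =
        Pi.single i 1 + fun l => if l ∈ C then 0 else μ l := fun hi => by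
      funext l
      by_cases hl : l ∈ C
      · have : l ≠ i := by rintro rfl; exact hi hl
        simp [hl, this]
      · simp [hl]
    have hrestC : i ∈ C → (fun l => if l ∈ C then 0 else (Pi.single i 1 + μ : ι → ℕ) l) =
        fun l => if l ∈ C then 0 else μ l := fun hi => by
      funext l
      by_cases hl : l ∈ C
      · simp [hl]
      · have : l ≠ i := by rintro rfl; exact hl hi
        simp [hl, this]
    rw [hsum]
    refine ⟨fun hi => ?_, fun hi => ?_⟩
    · rw [hrestN hi, if_neg hi]
      by_cases hk : k ∈ C
      · obtain ⟨p, a, z, hp, ha, hz, hw⟩ := ih₂ hk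
        obtain ⟨b, hb, hbx⟩ := exists_ofReal_of_le (X := minSchur C r B i p) (y := x + a) (by
          rw [minSchur_apply, ← ofReal_mul, ← ha, ← h]
          refine (add_le_right _ _).trans ((mul_apply_le _ _ i k p).trans ?_)
          rw [block_apply (by simpa using hi) hk])
        exact ⟨b + z, by linarith, .cons hb hw⟩
      · obtain ⟨z, hz, hw⟩ := ih₁ hk
        obtain ⟨b, hb, hbx⟩ := exists_ofReal_of_le (X := minSchur C r B i k) (y := x) (by
          rw [minSchur_apply, ← h]
          refine (add_le_left _ _).trans ?_
          rw [block_apply (by simpa using hi) (by simpa using hk)])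
        exact ⟨b + z, by linarith, .cons hb hw⟩
    · rw [hrestC hi, if_pos hi]
      by_cases hk : k ∈ C
      · obtain ⟨p, a, z, hp, ha, hz, hw⟩ := ih₂ hk
        obtain ⟨q, c, e, hc, he, rfl⟩ := mul_apply_eq_ofReal ha
        obtain ⟨ν, hν⟩ := exists_walk_of_kleeneStar hM hc
        have harc : (ofReal (-r) • block B C C) i k = ofReal (-r + x) := by
          rw [Matrix.smul_apply, smul_eq_mul, block_apply hi hk, h, ofReal_mul]
        have hst := kleeneStar_le_of_walk hM (IsWalk.cons harc hν)
        obtain ⟨b, hb, hbx⟩ := exists_ofReal_of_le (X := (kleeneStar (ofReal (-r) • block B C C) *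
          (ofReal (-r) • block B C Cᶜ)) i p) (y := (-r + x + c) + e) (by
            refine (mul_apply_le _ _ i q p).trans ?_
            rw [he, ← ofReal_mul _ e]
            exact mul_le_mul_left hst _)
        exact ⟨p, b, z, hp, hb, by linarith, hw⟩
      · obtain ⟨z, hz, hw⟩ := ih₁ hk
        have hst := kleeneStar_le_of_walk hM (IsWalk.nil i)
        obtain ⟨b, hb, hbx⟩ := exists_ofReal_of_le (X := (kleeneStar (ofReal (-r) • block B C C) *
          (ofReal (-r) • block B C Cᶜ)) i k) (y := 0 + (-r + x)) (by
            refine (mul_apply_le _ _ i i k).trans ?_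
            rw [Matrix.smul_apply, smul_eq_mul, block_apply hi (by simpa using hk), h, ofReal_mul,
              ← ofReal_mul 0]
            exact mul_le_mul_left hst _)
        exact ⟨k, b, z, hk, hb, by linarith, hw⟩

/-- Walks between nodes outside of `C` induce walks of the Schur complement. -/
theorem exists_walk_minSchur (hC : ∀ i x μ, IsWalk B i i x μ → r * ∑ l, (μ l : ℝ) ≤ x)
    {i j : ι} {x : ℝ} {μ : ι → ℕ} (h : IsWalk B i j x μ) (hi : i ∉ C) (hj : j ∉ C) :
    ∃ y ≤ x - r * ∑ l ∈ C, (μ l : ℝ),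
      IsWalk (minSchur C r B) i j y (fun l => if l ∈ C then 0 else μ l) :=
  (exists_walk_minSchur_aux hC h hj).1 hi

end Schur

/-! ### The sequence of Schur complements -/

/-- The critical value of the first set `C_m` that contains `j`. -/
noncomputable def nodeVal (A : Matrix ι ι Rmin) (j : ι) : ℝ := critVal A (sInf {m | j ∈ critSet A m})

/-- The diagonal of `D_ℓ`: it is `α_m` on `C_m` for `m < ℓ`, and `α_ℓ` at the other nodes. -/
noncomputable def ordVal (A : Matrix ι ι Rmin) (l : ℕ) (j : ι) : ℝ :=
  if j ∈ cumSet A (l - 1) then nodeVal A j else critVal A l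

theorem cumSet_zero : cumSet A 0 = ∅ := by simp [cumSet]

theorem cumSet_succ (m : ℕ) : cumSet A (m + 1) = cumSet A m ∪ critSet A (m + 1) := by
  ext i
  simp only [cumSet, Finset.mem_biUnion, Finset.mem_Icc, Finset.mem_union]
  constructor
  · rintro ⟨j, ⟨h1, h2⟩, hj⟩
    rcases Nat.lt_or_ge j (m + 1) with h | h
    · exact Or.inl ⟨j, ⟨h1, by omega⟩, hj⟩
    · exact Or.inr ((by omega : j = m + 1) ▸ hj)
  · rintro (⟨j, ⟨h1, h2⟩, hj⟩ | h)
    · exact ⟨j, ⟨h1, by omega⟩, hj⟩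
    · exact ⟨m + 1, ⟨by omega, le_rfl⟩, h⟩

theorem critSet_succ (m : ℕ) : critSet A (m + 1) = critNodes (seqMat A (m + 1)) := by
  simp [critSet]

theorem cumSet_ne_univ {m : ℕ} (hm : m < numCrit A) : cumSet A m ≠ Finset.univ :=
  fun h => Nat.notMem_of_lt_sInf hm h

/-- `A_{m+1}` is the Schur complement of `C^m`: its walks correspond to the walks of `A`. -/
structure IsReduced (A : Matrix ι ι Rmin) (m : ℕ) : Prop where
  project : ∀ {i j : ι} {x : ℝ} {μ : ι → ℕ}, IsWalk A i j x μ → i ∉ cumSet A m → j ∉ cumSet A m →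
    ∃ y ≤ x - ∑ l ∈ cumSet A m, μ l * nodeVal A l,
      IsWalk (seqMat A (m + 1)) i j y (fun l => if l ∈ cumSet A m then 0 else μ l)
  lift : ∀ {i j : ι} {x : ℝ} {μ : ι → ℕ}, IsWalk (seqMat A (m + 1)) i j x μ →
    (∀ l ∈ cumSet A m, μ l = 0) ∧ ∃ ν : ι → ℕ,
      IsWalk A i j (x + ∑ l, ν l * nodeVal A l) (μ + ν) ∧ ∀ l ∉ cumSet A m, ν l = 0

theorem isReduced_zero : IsReduced A 0 where
  project := fun {i j x μ} h _ _ => ⟨x, by simp [cumSet_zero],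
    by simpa [cumSet_zero] using (show IsWalk (seqMat A 1) i j x μ from h)⟩
  lift := fun {i j x μ} h => ⟨by simp [cumSet_zero], 0, by simpa using (show IsWalk A i j x μ from h), by simp⟩

/-- By irreducibility, a node not yet eliminated is on a circuit of `A`; its projection still visits
that node. -/
theorem IsReduced.exists_circuit {m : ℕ} (h : IsReduced A m) (hA : IsIrreducible A)
    (hm : cumSet A m ≠ Finset.univ) : ∃ i x μ, IsWalk (seqMat A (m + 1)) i i x μ ∧ μ ≠ 0 := by
  obtain ⟨i, hi⟩ : ∃ i, i ∉ cumSet A m := by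
    by_contra! hcon
    exact hm (Finset.eq_univ_iff_forall.2 hcon)
  obtain ⟨x, μ, hw, h0⟩ := exists_isWalk_of_transGen (hA i i)
  obtain ⟨y, -, hy⟩ := h.project hw hi hi
  refine ⟨i, y, _, hy, fun h => ?_⟩
  have := congrFun h i
  simp only [hi, if_false, Pi.zero_apply] at this
  exact (hw.pos_start h0).ne' this

theorem IsReduced.notMem_of_mem_critSet {m : ℕ} (h : IsReduced A m) {i : ι}
    (hi : i ∈ critSet A (m + 1)) : i ∉ cumSet A m := by
  intro hc
  obtain ⟨μ, hw, hp⟩ := mem_critNodes.1 (critSet_succ (A := A) m ▸ hi)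
  exact hp.ne' ((h.lift hw).1 i hc)

/-- A node of `C_{m+1}` is in no earlier `C_j`, so the infimum in `nodeVal` is `m + 1`; the index
`0` is excluded by `C_0 = ∅`. -/
theorem IsReduced.nodeVal_eq {m : ℕ} (h : IsReduced A m) {i : ι}
    (hi : i ∈ critSet A (m + 1)) : nodeVal A i = critVal A (m + 1) := by
  have h1 : sInf {m | i ∈ critSet A m} ≤ m + 1 := Nat.sInf_le hi
  have h2 : i ∈ critSet A (sInf {m | i ∈ critSet A m}) := Nat.sInf_mem (s := {m | i ∈ critSet A m}) ⟨m + 1, hi⟩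
  rw [nodeVal]
  rcases h1.lt_or_eq with h3 | h3
  · exfalso
    refine h.notMem_of_mem_critSet hi (Finset.mem_biUnion.2 ⟨_, Finset.mem_Icc.2 ⟨?_, by omega⟩, h2⟩)
    by_contra! h4
    rw [Nat.lt_one_iff.1 h4] at h2
    simp [critSet] at h2
  · rw [h3]

/-- Correspondences of walks compose: the passage from `A_{m+1}` to `A_{m+2}` charges `α_{m+1}` on
`C_{m+1}`, which is disjoint from the nodes already charged. -/
theorem IsReduced.succ {m : ℕ} (h : IsReduced A m) (hA : IsIrreducible A)
    (hm : cumSet A m ≠ Finset.univ) : IsReduced A (m + 1) := by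
  have hC := (rhoMin_spec (h.exists_circuit hA hm)).1
  have hdisj : Disjoint (cumSet A m) (critSet A (m + 1)) :=
    Finset.disjoint_right.2 fun i hi => h.notMem_of_mem_critSet hi
  have hS : seqMat A (m + 1 + 1) =
      minSchur (critSet A (m + 1)) (rhoMin (seqMat A (m + 1))) (seqMat A (m + 1)) := by
    rw [critSet_succ]; rfl
  constructor
  · intro i j x μ hw hi hj
    rw [cumSet_succ, Finset.mem_union, not_or] at hi hj
    obtain ⟨y, hy, hw'⟩ := h.project hw hi.1 hj.1
    obtain ⟨z, hz, hw''⟩ := exists_walk_minSchur hC hw' hi.2 hj.2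
    refine ⟨z, ?_, ?_⟩
    · rw [cumSet_succ, Finset.sum_union hdisj]
      have : ∑ l ∈ critSet A (m + 1), (μ l : ℝ) * nodeVal A l = rhoMin (seqMat A (m + 1)) *
          ∑ l ∈ critSet A (m + 1), ((if l ∈ cumSet A m then 0 else μ l : ℕ) : ℝ) := by
        rw [Finset.mul_sum]
        refine Finset.sum_congr rfl fun l hl => ?_
        rw [h.nodeVal_eq hl, if_neg (h.notMem_of_mem_critSet hl), mul_comm]
        rfl
      linarith
    · rw [hS]
      convert hw'' using 1
      funext l
      simp only [cumSet_succ, Finset.mem_union]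
      by_cases h1 : l ∈ cumSet A m <;> by_cases h2 : l ∈ critSet A (m + 1) <;> simp [h1, h2]
  · intro i j x μ hw
    rw [hS] at hw
    obtain ⟨h0, ν, hν, hs⟩ := minSchur_walk_lift hC hw
    obtain ⟨h0', ν', hν', hs'⟩ := h.lift hν
    refine ⟨fun l hl => ?_, ν + ν', ?_, fun l hl => ?_⟩
    · rw [cumSet_succ, Finset.mem_union] at hl
      rcases hl with hl | hl
      · have := h0' l hl
        simp at this
        exact this.1
      · exact h0 l hl
    · convert hν' using 1
      · have : ∑ l, (ν l : ℝ) * nodeVal A l = rhoMin (seqMat A (m + 1)) * ∑ l, (ν l : ℝ) := by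
          rw [Finset.mul_sum]
          refine Finset.sum_congr rfl fun l _ => ?_
          by_cases hl : l ∈ critSet A (m + 1)
          · rw [h.nodeVal_eq hl, mul_comm]
            rfl
          · simp [hs l hl]
        simp only [Pi.add_apply, Nat.cast_add, add_mul, Finset.sum_add_distrib, this]
        ring
      · abel
    · rw [cumSet_succ, Finset.mem_union, not_or] at hl
      simp [hs l hl.2, hs' l hl.1]

theorem isReduced (hA : IsIrreducible A) {m : ℕ} (hm : m ≤ numCrit A) : IsReduced A m := by
  induction m with
  | zero => exact isReduced_zero
  | succ m ih => exact (ih (by omega)).succ hA (cumSet_ne_univ (by omega))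

theorem critVal_spec (hA : IsIrreducible A) {m : ℕ} (hm : m < numCrit A) :
    (∀ i x μ, IsWalk (seqMat A (m + 1)) i i x μ → critVal A (m + 1) * ∑ l, (μ l : ℝ) ≤ x) ∧
      ∃ i μ, IsWalk (seqMat A (m + 1)) i i (critVal A (m + 1) * ∑ l, (μ l : ℝ)) μ ∧ μ ≠ 0 :=
  rhoMin_spec ((isReduced hA hm.le).exists_circuit hA (cumSet_ne_univ hm))

theorem mem_critSet_of_walk (hA : IsIrreducible A) {m : ℕ} (hm : m < numCrit A) {i : ι} {x : ℝ}
    {μ : ι → ℕ} (h : IsWalk (seqMat A (m + 1)) i i x μ)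
    (hx : x ≤ critVal A (m + 1) * ∑ l, (μ l : ℝ)) {j : ι} (hj : 0 < μ j) :
    j ∈ critSet A (m + 1) := by
  rw [critSet_succ, mem_critNodes]
  have : x = rhoMin (seqMat A (m + 1)) * ∑ l, (μ l : ℝ) :=
    le_antisymm hx ((critVal_spec hA hm).1 _ _ _ h)
  exact ⟨μ, this ▸ h.rotate hj, hj⟩

/-- If `α_{m+2} ≤ α_{m+1}`, a critical circuit of `A_{m+2}` lifts to a circuit of `A_{m+1}` of mean
at most `α_{m+1}`. The lift is then critical and stays in `C_{m+1}`, although it visits nodes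
outside of it. -/
theorem critVal_lt_succ (hA : IsIrreducible A) {m : ℕ} (hm : m + 1 < numCrit A) :
    critVal A (m + 1) < critVal A (m + 2) := by
  by_contra! hcon
  obtain ⟨i, μ, hw, h0⟩ := (critVal_spec hA hm).2
  have hS : seqMat A (m + 1 + 1) =
      minSchur (critSet A (m + 1)) (critVal A (m + 1)) (seqMat A (m + 1)) := by
    rw [critSet_succ]; rfl
  rw [hS] at hw
  obtain ⟨hμ, ν, hν, -⟩ := minSchur_walk_lift (critVal_spec hA (by omega : m < numCrit A)).1 hw
  have hi := hw.pos_start h0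
  refine hi.ne' (hμ i (mem_critSet_of_walk hA (by omega) hν ?_ ?_))
  · have : (0 : ℝ) ≤ ∑ l, (μ l : ℝ) := Finset.sum_nonneg fun _ _ => by positivity
    simp only [Pi.add_apply, Nat.cast_add, Finset.sum_add_distrib]
    nlinarith [mul_le_mul_of_nonneg_right hcon this]
  · simp [hi]

theorem critVal_lt (hA : IsIrreducible A) {j m : ℕ} (hj : 1 ≤ j) (hjm : j ≤ m)
    (hm : m < numCrit A) : critVal A j < critVal A (m + 1) := by
  induction m with
  | zero => omega
  | succ m ih =>
    have h1 := critVal_lt_succ hA hm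
    rcases hjm.lt_or_eq with h | rfl
    · exact (ih (by omega) (by omega)).trans h1
    · exact h1

theorem exists_level (hA : IsIrreducible A) {m : ℕ} (hm : m ≤ numCrit A) {i : ι}
    (hi : i ∈ cumSet A m) : ∃ j, 1 ≤ j ∧ j ≤ m ∧ i ∈ critSet A j ∧ nodeVal A i = critVal A j := by
  obtain ⟨j, hj, hij⟩ := Finset.mem_biUnion.1 hi
  obtain ⟨h1, h2⟩ := Finset.mem_Icc.1 hj
  obtain ⟨j, rfl⟩ := Nat.exists_eq_add_of_le' h1
  exact ⟨j + 1, h1, h2, hij, (isReduced hA (by omega)).nodeVal_eq hij⟩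

/-- This strict inequality makes `z` disappear from the rows of `C^{ℓ-1}` in the limit pencil. -/
theorem ordVal_lt (hA : IsIrreducible A) {m : ℕ} (hm : m < numCrit A) {i : ι}
    (hi : i ∈ cumSet A m) : ordVal A (m + 1) i < critVal A (m + 1) := by
  obtain ⟨j, h1, h2, -, h⟩ := exists_level hA hm.le hi
  simp only [ordVal, Nat.add_sub_cancel, hi, if_true, h]
  exact critVal_lt hA h1 h2 hm

theorem ordVal_eq_nodeVal (hA : IsIrreducible A) {m : ℕ} (hm : m < numCrit A) {i : ι}
    (hi : i ∈ cumSet A (m + 1)) : ordVal A (m + 1) i = nodeVal A i := by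
  simp only [ordVal, Nat.add_sub_cancel]
  split_ifs with h
  · rfl
  · rw [cumSet_succ, Finset.mem_union] at hi
    exact ((isReduced hA hm.le).nodeVal_eq (hi.resolve_left h)).symm

theorem cumSet_mono {m p : ℕ} (h : m ≤ p) : cumSet A m ⊆ cumSet A p :=
  Finset.biUnion_subset_biUnion_of_subset_left _ (Finset.Icc_subset_Icc_right h)

theorem ordVal_eq_ordVal (hA : IsIrreducible A) {m p : ℕ} (hmp : m ≤ p) (hp : p < numCrit A)
    {i : ι} (hi : i ∈ cumSet A (m + 1)) : ordVal A (m + 1) i = ordVal A (p + 1) i := by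
  rw [ordVal_eq_nodeVal hA (by omega) hi,
    ordVal_eq_nodeVal hA hp (cumSet_mono (by omega) hi)]

/-- The first sum is what the reduction to `A_{m+1}` subtracts from the weight, the second is
`α_{m+1}` times the length of the reduced walk. -/
theorem sum_ordVal (m : ℕ) (μ : ι → ℕ) : ∑ l, μ l * ordVal A (m + 1) l =
    ∑ l ∈ cumSet A m, μ l * nodeVal A l +
      critVal A (m + 1) * ∑ l, ((if l ∈ cumSet A m then 0 else μ l : ℕ) : ℝ) := by
  rw [← Finset.univ_inter (cumSet A m), ← Finset.sum_ite_mem, Finset.mul_sum,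
    ← Finset.sum_add_distrib]
  refine Finset.sum_congr rfl fun l _ => ?_
  by_cases h : l ∈ cumSet A m <;> simp [ordVal, h, mul_comm]

/-- The circuits of `D_ℓ⁻¹ A` have non-negative weights, and those of weight zero visit
only nodes of `C^ℓ`. -/
theorem circuit_bound (hA : IsIrreducible A) {m : ℕ} (hm : m < numCrit A) {i : ι} {x : ℝ}
    {μ : ι → ℕ} (h : IsWalk A i i x μ) : ∑ l, μ l * ordVal A (m + 1) l ≤ x ∧
      (x ≤ ∑ l, μ l * ordVal A (m + 1) l → ∀ l, 0 < μ l → l ∈ cumSet A (m + 1)) := by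
  have hred := isReduced hA hm.le
  -- A circuit leaving `C^m` projects to a circuit of `A_{m+1}`, to which the minimal mean applies.
  -- A circuit inside `C^m` is treated by recursion on `m`.
  by_cases hex : ∃ j, j ∉ cumSet A m ∧ 0 < μ j
  · obtain ⟨j, hj, hpos⟩ := hex
    obtain ⟨y, hy, hw⟩ := hred.project (h.rotate hpos) hj hj
    have := (critVal_spec hA hm).1 _ _ _ hw
    rw [sum_ordVal]
    refine ⟨by linarith, fun hx l hl => ?_⟩
    rw [cumSet_succ, Finset.mem_union]
    by_cases hlm : l ∈ cumSet A m
    · exact Or.inl hlm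
    · exact Or.inr (mem_critSet_of_walk hA hm hw (by linarith) (by simpa [hlm] using hl))
  · push Not at hex
    have hsupp : ∀ l, 0 < μ l → l ∈ cumSet A m := fun l hl => by
      by_contra hcon
      have := hex l hcon
      omega
    refine ⟨?_, fun _ l hl => cumSet_mono (by omega) (hsupp l hl)⟩
    cases m with
    | zero =>
      have : μ = 0 := by
        funext l
        by_contra hcon
        simpa [cumSet_zero] using hsupp l (Nat.pos_of_ne_zero hcon)
      subst this
      simp [h.eq_of_zero.2]
    | succ m =>
      -- On the nodes of this circuit the two consecutive diagonals agree.
      refine le_trans (le_of_eq ?_) (circuit_bound hA (m := m) (by omega) h).1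
      refine Finset.sum_congr rfl fun l _ => ?_
      rcases Nat.eq_zero_or_pos (μ l) with h0 | h0
      · simp [h0]
      · rw [ordVal_eq_ordVal hA (p := m + 1) (by omega) hm (hsupp l h0)]

/-- Every node of `C^ℓ` is on a circuit of `D_ℓ⁻¹ A` of weight zero. -/
theorem exists_tight_circuit (hA : IsIrreducible A) {m : ℕ} (hm : m < numCrit A) {i : ι}
    (hi : i ∈ cumSet A (m + 1)) :
    ∃ μ, IsWalk A i i (∑ l, μ l * ordVal A (m + 1) l) μ ∧ 0 < μ i := by
  obtain ⟨j, h1, h2, hij, -⟩ := exists_level hA (by omega) hi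
  obtain ⟨j, rfl⟩ := Nat.exists_eq_add_of_le' h1
  have hred := isReduced hA (by omega : j ≤ numCrit A)
  obtain ⟨μ, hw, hp⟩ := mem_critNodes.1 (critSet_succ (A := A) j ▸ hij)
  obtain ⟨h0, ν, hν, hs⟩ := hred.lift hw
  -- The lift of a critical circuit of `A_{j+1}` has weight zero for `D_{j+1}⁻¹ A`. It therefore
  -- stays in `C^{j+1}`, where `D_{j+1}` and `D_{m+1}` agree.
  have hx : rhoMin (seqMat A (j + 1)) * ∑ l, (μ l : ℝ) + ∑ l, ν l * nodeVal A l =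
      ∑ l, ((μ + ν) l : ℕ) * ordVal A (j + 1) l := by
    rw [Finset.mul_sum, ← Finset.sum_add_distrib]
    refine Finset.sum_congr rfl fun l _ => ?_
    by_cases hl : l ∈ cumSet A j
    · simp [h0 l hl, ordVal, hl]
    · simp [hs l hl, ordVal, hl, mul_comm, critVal]
  rw [hx] at hν
  have hsupp := (circuit_bound hA (by omega : j < numCrit A) hν).2 le_rfl
  have hx' : ∑ l, ((μ + ν) l : ℕ) * ordVal A (j + 1) l =
      ∑ l, ((μ + ν) l : ℕ) * ordVal A (m + 1) l := by
    refine Finset.sum_congr rfl fun l _ => ?_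
    rcases Nat.eq_zero_or_pos ((μ + ν) l) with h0 | h0
    · simp [h0]
    · rw [ordVal_eq_ordVal hA (p := m) (by omega) hm (hsupp l h0)]
  exact ⟨μ + ν, hx' ▸ hν, by simp [hp]⟩

/-- Critical circuits of order `ℓ` are the circuits of `D_ℓ⁻¹ A` of weight zero. -/
theorem isCriticalCircuitOfOrder_iff (hA : IsIrreducible A) {m : ℕ} (hm : m < numCrit A) {k : ℕ}
    {c : ℕ → ι} : IsCriticalCircuitOfOrder A (m + 1) k c ↔ IsCircuit (arcs A) k c ∧
      weight A k c = ∑ i, visitCount k c i * ordVal A (m + 1) i := by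
  have hbu : ∀ f : ι → ℝ, ∑ i ∈ cumSet A m, f i =
      ∑ j ∈ Finset.Ico 1 (m + 1), ∑ i ∈ critSet A j, f i := by
    intro f
    rw [cumSet, Finset.sum_biUnion]
    · rfl
    · have aux : ∀ p q, 1 ≤ p → p < q → q ≤ m → Disjoint (critSet A p) (critSet A q) := by
        intro p q hp hpq hq
        obtain ⟨q, rfl⟩ := Nat.exists_eq_add_of_le' (hp.trans hpq.le)
        refine Finset.disjoint_right.2 fun i hi hi' => ?_
        exact (isReduced hA (by omega : q ≤ numCrit A)).notMem_of_mem_critSet hi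
          (Finset.mem_biUnion.2 ⟨p, Finset.mem_Icc.2 ⟨hp, by omega⟩, hi'⟩)
      intro p hp q hq hpq
      rw [Finset.mem_coe, Finset.mem_Icc] at hp hq
      rcases hpq.lt_or_gt with h | h
      · exact aux p q hp.1 h hq.2
      · exact (aux q p hq.1 h hp.2).symm
  have h1 : ∑ i ∈ cumSet A m, visitCount k c i * nodeVal A i =
      ∑ j ∈ Finset.Ico 1 (m + 1), critVal A j * visits (critSet A j) k c := by
    rw [hbu]
    refine Finset.sum_congr rfl fun j hj => ?_
    obtain ⟨hj1, hj2⟩ := Finset.mem_Ico.1 hj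
    obtain ⟨j, rfl⟩ := Nat.exists_eq_add_of_le' hj1
    rw [visits_eq_sum, Finset.mul_sum]
    refine Finset.sum_congr rfl fun i hi => ?_
    rw [(isReduced hA (by omega : j ≤ numCrit A)).nodeVal_eq hi, mul_comm]
  have h2 : ∑ l, ((if l ∈ cumSet A m then 0 else visitCount k c l : ℕ) : ℝ) =
      lengthOrd A (m + 1) k c := by
    have : ∑ l ∈ cumSet A m, (visitCount k c l : ℝ) =
        ∑ j ∈ Finset.Ico 1 (m + 1), (visits (critSet A j) k c : ℝ) := by
      rw [hbu]
      exact Finset.sum_congr rfl fun j hj => (visits_eq_sum _ _ _).symm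
    rw [lengthOrd, ← this, eq_sub_iff_add_eq, ← Finset.univ_inter (cumSet A m),
      ← Finset.sum_ite_mem, ← Finset.sum_add_distrib]
    rw [show (k : ℝ) = ((∑ i, visitCount k c i : ℕ) : ℝ) by rw [sum_visitCount_nat], Nat.cast_sum]
    refine Finset.sum_congr rfl fun l _ => ?_
    by_cases h : l ∈ cumSet A m <;> simp [h]
  rw [IsCriticalCircuitOfOrder, sum_ordVal, h1, h2, weightOrd, sub_eq_iff_eq_add']
  simp

/-- The nodes of the critical graph of order `ℓ` are those of `C^ℓ`. -/
theorem nodesOf_critical (hA : IsIrreducible A) {m : ℕ} (hm : m < numCrit A) :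
    nodesOf (IsCriticalCircuitOfOrder A (m + 1)) = cumSet A (m + 1) := by
  ext i
  simp only [nodesOf, Finset.mem_filter, Finset.mem_univ, true_and]
  constructor
  · rintro ⟨k, c, hc, hi⟩
    obtain ⟨hc, hx⟩ := (isCriticalCircuitOfOrder_iff hA hm).1 hc
    exact (circuit_bound hA hm hc.isWalk).2 hx.le i (visitCount_pos.2 hi)
  · intro hi
    obtain ⟨μ, hw, hp⟩ := exists_tight_circuit hA hm hi
    obtain ⟨k, c, hc, hx, rfl⟩ := hw.exists_circuit (fun h => by simp [h] at hp)
    exact ⟨k, c, (isCriticalCircuitOfOrder_iff hA hm).2 ⟨hc, hx⟩, visitCount_pos.1 hp⟩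

/-- Critical circuits of order `ℓ` are critical of any larger order. -/
theorem IsCriticalCircuitOfOrder.mono (hA : IsIrreducible A) {m p : ℕ} (hmp : m ≤ p)
    (hp : p < numCrit A) {k : ℕ} {c : ℕ → ι} (h : IsCriticalCircuitOfOrder A (m + 1) k c) :
    IsCriticalCircuitOfOrder A (p + 1) k c := by
  obtain ⟨hc, hx⟩ := (isCriticalCircuitOfOrder_iff hA (by omega)).1 h
  have hsupp := (circuit_bound hA (by omega) hc.isWalk).2 hx.le
  refine (isCriticalCircuitOfOrder_iff hA hp).2 ⟨hc, hx.trans ?_⟩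
  refine Finset.sum_congr rfl fun l _ => ?_
  rcases Nat.eq_zero_or_pos (visitCount k c l) with h0 | h0
  · simp [h0]
  · rw [ordVal_eq_ordVal hA hmp hp (hsupp l h0)]

/-! ### Potentials -/

/-- Take for `v` a column of the Kleene star of `diag(d)⁻¹ A`: it is finite by irreducibility, and
the inequality says that putting an arc in front of an optimal walk cannot beat the optimum. -/
theorem exists_potential (hA : IsIrreducible A) (d : ι → ℝ)
    (hd : ∀ i x μ, IsWalk A i i x μ → ∑ l, μ l * d l ≤ x) :
    ∃ v : ι → ℝ, ∀ i j x, A i j = ofReal x → d i + v i ≤ x + v j := by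
  rcases isEmpty_or_nonempty ι with _ | ⟨⟨i₀⟩⟩
  · exact ⟨fun _ => 0, fun i => isEmptyElim i⟩
  set M : Matrix ι ι Rmin := Matrix.of fun i j => ofReal (-d i) * A i j
  have hMd : ∀ i j, M i j = ofReal (-d i) * A i j := fun _ _ => rfl
  have hM : ∀ i x μ, IsWalk M i i x μ → 0 ≤ x := by
    intro i x μ h
    have := hd _ _ _ (h.shift d (B' := A) fun i j => by
      rw [hMd, ← mul_assoc, ofReal_mul, add_neg_cancel]
      exact (one_mul _).symm)
    linarith
  have hfin : ∀ i, ∃ v, kleeneStar M i i₀ = ofReal v := by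
    intro i
    obtain ⟨x, μ, hw, -⟩ := exists_isWalk_of_transGen (hA i i₀)
    have := hw.shift (B' := M) (fun i => -d i) hMd
    obtain ⟨v, hv, -⟩ := exists_ofReal_of_le (kleeneStar_le_of_walk hM this)
    exact ⟨v, hv⟩
  choose v hv using hfin
  refine ⟨v, fun i j x hx => ?_⟩
  obtain ⟨μ, hw⟩ := exists_walk_of_kleeneStar hM (hv j)
  have harc : M i j = ofReal (-d i + x) := by
    rw [hMd, hx, ofReal_mul]
  have := kleeneStar_le_of_walk hM (IsWalk.cons harc hw)
  rw [hv, ofReal_le_ofReal] at this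
  linarith

/-- On a circuit of weight zero, the inequalities of a potential are equalities. -/
theorem tight_arcs {d v : ι → ℝ} (hv : ∀ i j x, A i j = ofReal x → d i + v i ≤ x + v j) {k : ℕ}
    {c : ℕ → ι} (hc : IsCircuit (arcs A) k c)
    (hw : weight A k c ≤ ∑ i, visitCount k c i * d i) {m : ℕ} (hm : m < k) :
    A (c m) (c (m + 1)) = ofReal (d (c m) + v (c m) - v (c (m + 1))) := by
  set a : ℕ → ℝ := fun m => (Tropical.untrop (A (c m) (c (m + 1)))).untopD 0
  have ha : ∀ m < k, A (c m) (c (m + 1)) = ofReal (a m) := fun m hm => by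
    obtain ⟨x, hx⟩ := exists_ofReal_of_ne_zero (hc.2.2 m hm)
    have : a m = x := by simp only [a, hx]; rfl
    rw [hx, this]
  -- The slacks of the arcs are non-negative; the potential telescopes around the circuit, so their
  -- sum is at most zero.
  have hnn : ∀ m ∈ Finset.range k, 0 ≤ a m - d (c m) + (v (c (m + 1)) - v (c m)) := fun m hm => by
    have := hv _ _ _ (ha m (Finset.mem_range.1 hm))
    linarith
  have hsum : ∑ m ∈ Finset.range k, (a m - d (c m) + (v (c (m + 1)) - v (c m))) = 0 := by
    refine le_antisymm ?_ (Finset.sum_nonneg hnn)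
    rw [Finset.sum_add_distrib, Finset.sum_range_sub (fun m => v (c m)), hc.2.1, sub_self,
      Finset.sum_sub_distrib]
    rw [sum_visitCount] at hw
    simp only [weight] at hw
    linarith
  have := (Finset.sum_eq_zero_iff_of_nonneg hnn).1 hsum m (Finset.mem_range.2 hm)
  rw [ha m hm, ofReal_inj]
  linarith

/-! ### Admissible graphs -/

theorem hatMat_apply (A : Matrix ι ι Rmin) (i j : ι) :
    hatMat A i j = ofReal (-diagD A i) * A i j := by
  rw [hatMat, Matrix.diagonal_mul]

theorem arcs_hatMat {i j : ι} : arcs (hatMat A) i j ↔ arcs A i j := by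
  simp [arcs, hatMat_apply, ofReal_ne_zero]

theorem diagD_eq (A : Matrix ι ι Rmin) (i : ι) : diagD A i = ordVal A (numCrit A) i := rfl

theorem weight_hatMat {k : ℕ} {c : ℕ → ι} (hc : IsCircuit (arcs A) k c) :
    weight (hatMat A) k c = weight A k c - ∑ i, visitCount k c i * diagD A i := by
  rw [sum_visitCount, weight, weight, ← Finset.sum_sub_distrib]
  refine Finset.sum_congr rfl fun m hm => ?_
  obtain ⟨x, hx⟩ := exists_ofReal_of_ne_zero (hc.2.2 m (Finset.mem_range.1 hm))
  rw [hatMat_apply, hx, ofReal_mul]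
  show -diagD A (c m) + x = x - diagD A (c m)
  ring

theorem hatMat_walk_nonneg (hA : IsIrreducible A) (hk : 0 < numCrit A) {i : ι} {x : ℝ} {μ : ι → ℕ}
    (h : IsWalk (hatMat A) i i x μ) : 0 ≤ x := by
  have h' := h.shift (diagD A) (B' := A) fun i j => by
    rw [hatMat_apply, ← mul_assoc, ofReal_mul, add_neg_cancel]
    exact (one_mul _).symm
  obtain ⟨p, hp⟩ := Nat.exists_eq_add_of_le' hk
  have := (circuit_bound hA (m := p) (by omega) h').1
  simp only [diagD_eq, hp] at this
  linarith

/-- Such a circuit is also critical of order `k`, and `D = D_k`. -/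
theorem weight_hatMat_eq_zero (hA : IsIrreducible A) {m : ℕ} (hm : m < numCrit A) {k : ℕ}
    {c : ℕ → ι} (h : IsCriticalCircuitOfOrder A (m + 1) k c) : weight (hatMat A) k c = 0 := by
  obtain ⟨p, hp⟩ := Nat.exists_eq_add_of_le' (by omega : 0 + 1 ≤ numCrit A)
  obtain ⟨hc, hx⟩ := (isCriticalCircuitOfOrder_iff hA (m := p) (by omega)).1
    (h.mono hA (by omega) (by omega))
  rw [weight_hatMat hc, hx, sub_eq_zero]
  simp only [diagD_eq, hp, Nat.zero_add]

theorem IsCriticalCircuitOfOrder.isCriticalCircuit (hA : IsIrreducible A) {m : ℕ}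
    (hm : m < numCrit A) {k : ℕ} {c : ℕ → ι} (h : IsCriticalCircuitOfOrder A (m + 1) k c) :
    IsCriticalCircuit (hatMat A) k c := by
  have hw := weight_hatMat_eq_zero hA hm h
  have hc : IsCircuit (arcs (hatMat A)) k c :=
    ⟨h.2.1.1, h.2.1.2.1, fun m hm => arcs_hatMat.2 (h.2.1.2.2 m hm)⟩
  obtain ⟨h1, i, μ, h2, h0⟩ := rhoMin_spec ⟨_, _, _, hc.isWalk, visitCount_ne_zero hc.1 c⟩
  have h3 := h1 _ _ _ hc.isWalk
  have h4 := hatMat_walk_nonneg hA (by omega) h2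
  rw [hw] at h3
  have h5 := nonneg_of_mul_nonneg_left h4 (sum_visits_pos h0)
  have h6 : rhoMin (hatMat A) ≤ 0 := by
    by_contra! hcon
    exact absurd h3 (mul_pos hcon (sum_visits_pos (visitCount_ne_zero hc.1 c))).not_ge
  exact ⟨hc, by rw [hw, zero_div]; exact le_antisymm h5 h6⟩

/-- Finiteness of an entry of `V` spreads backwards along arcs, because an arc from `i` to `k`
bounds `X * V i` by a finite value. Irreducibility reaches every node. -/
theorem IsEigenvector.exists_finite (hA : IsIrreducible A) {V : ι → Rmin}
    (hV : IsEigenvector A V) : ∃ (v : ι → ℝ) (x : ℝ), (∀ i, V i = ofReal (v i)) ∧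
      ∀ i, A.mulVec V i = ofReal (x + v i) := by
  obtain ⟨h0, X, hX⟩ := hV
  obtain ⟨j, hj⟩ := Function.ne_iff.1 h0
  have step : ∀ i k, arcs A i k → V k ≠ 0 → V i ≠ 0 ∧ X ≠ 0 := by
    intro i k hik hk
    obtain ⟨a, ha⟩ := exists_ofReal_of_ne_zero hik
    obtain ⟨b, hb⟩ := exists_ofReal_of_ne_zero hk
    have hle : A.mulVec V i ≤ ofReal (a + b) := by
      rw [← ofReal_mul, ← ha, ← hb]
      exact sum_le_of_mem Finset.univ (fun l => A i l * V l) (Finset.mem_univ k)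
    rw [hX] at hle
    obtain ⟨c, hc, -⟩ := exists_ofReal_of_le hle
    obtain ⟨p, q, hp, hq, -⟩ := mul_eq_ofReal (show X * V i = ofReal c from hc)
    rw [hp, hq]
    exact ⟨ofReal_ne_zero _, ofReal_ne_zero _⟩
  have hall : ∀ i, V i ≠ 0 ∧ X ≠ 0 := by
    intro i
    induction hA i j using Relation.TransGen.head_induction_on with
    | single h => exact step _ _ h hj
    | head h _ ih => exact step _ _ h ih.1
  choose v hv using fun i => exists_ofReal_of_ne_zero (hall i).1
  obtain ⟨x, rfl⟩ := exists_ofReal_of_ne_zero (hall j).2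
  refine ⟨v, x, hv, fun i => ?_⟩
  rw [hX, Pi.smul_apply, smul_eq_mul, hv, ofReal_mul]

/-- Admissible graphs contain the critical circuits of any order. -/
theorem IsAdmissibleGraph.of_critical (hA : IsIrreducible A) {G : ι → ι → Prop}
    (hG : IsAdmissibleGraph A G) {m : ℕ} (hm : m < numCrit A) {i j : ι}
    (h : arcsOf (IsCriticalCircuitOfOrder A (m + 1)) i j) : G i j := by
  obtain ⟨k, c, hc, p, hp, rfl, rfl⟩ := h
  have hcrit := hc.isCriticalCircuit hA hm
  rcases hG with rfl | ⟨V, hV, rfl⟩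
  · exact ⟨k, c, hcrit, p, hp, rfl, rfl⟩
  have hA' : IsIrreducible (hatMat A) := fun i j =>
    Relation.TransGen.mono (fun _ _ => arcs_hatMat.2) i j (hA i j)
  obtain ⟨v, x, hv, hx⟩ := hV.exists_finite hA'
  obtain ⟨w, hw⟩ := exists_potential hA' (fun _ => 0) fun i y μ h => by
    simpa using hatMat_walk_nonneg hA (by omega) h
  -- Compare `v` with a potential `w` of `Â` at a node minimising `v - w`, along an arc attaining
  -- `(ÂV)_i`.
  have hx0 : 0 ≤ x := by
    obtain ⟨i, -, hi⟩ := Finset.exists_min_image Finset.univ (fun i => v i - w i) ⟨c 0, by simp⟩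
    obtain ⟨j, -, hj⟩ := exists_eq_of_sum_eq_ofReal _ _ (hx i)
    obtain ⟨a, b, ha, hb, hab⟩ := mul_eq_ofReal hj
    have h1 := hw _ _ _ ha
    have h2 := hi j (Finset.mem_univ j)
    rw [hv, ofReal_inj] at hb
    linarith
  -- The eigenvector is a potential for the constant diagonal `x`. As `x ≥ 0`, a circuit of weight
  -- zero satisfies the weight bound and is saturated.
  have htight := tight_arcs (A := hatMat A) (d := fun _ => x) (v := v) (fun i j y hy => by
    have h1 : (hatMat A).mulVec V i ≤ hatMat A i j * V j :=
      sum_le_of_mem Finset.univ (fun l => hatMat A i l * V l) (Finset.mem_univ j)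
    rwa [hx, hy, hv, ofReal_mul, ofReal_le_ofReal] at h1) hcrit.1 (by
      rw [weight_hatMat_eq_zero hA hm hc]
      exact Finset.sum_nonneg fun _ _ => by positivity) hp
  rw [satArcs, hx, htight, hv, ofReal_mul, ofReal_inj]
  ring

/-! ### Disjoint circuit covers -/

/-- Each node is sent to its successor on its circuit. Positions are reduced modulo the length
because disjointness is only given for positions below it. -/
theorem HasDisjointCircuitCover.exists_perm {W : Finset ι} {R : ι → ι → Prop}
    (h : HasDisjointCircuitCover W R) (hR : ∀ i j, R i j → i ∈ W) :
    ∃ σ : Equiv.Perm {i // i ∈ W}, ∀ i, R i.1 (σ i).1 := by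
  obtain ⟨q, len, c, hc, hd, hW⟩ := h
  have hlt : ∀ s m, (m + 1) % len s < len s := fun s m => Nat.mod_lt _ (hc s).1
  have hmem : ∀ s m, m < len s → c s m ∈ W := fun s m hm => hR _ _ ((hc s).2.2 m hm)
  have hnext : ∀ s m, m < len s → c s ((m + 1) % len s) = c s (m + 1) := fun s m hm => by
    rcases (show m + 1 ≤ len s from hm).lt_or_eq with h | h
    · rw [Nat.mod_eq_of_lt h]
    · rw [h, Nat.mod_self, ← (hc s).2.1, ← h]
  choose s m hm hcm using fun i : {i // i ∈ W} => hW i.1 i.2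
  let f : {i // i ∈ W} → {i // i ∈ W} := fun i => ⟨c (s i) ((m i + 1) % len (s i)), hmem _ _ (hlt _ _)⟩
  have hf : Function.Injective f := by
    intro i j hij
    obtain ⟨hs, hmm⟩ := hd _ _ _ (hlt _ _) _ (hlt _ _) (congrArg Subtype.val hij)
    apply Subtype.ext
    rw [← hcm i, ← hcm j]
    have h1 := hm i
    have h2 := hm j
    rw [hs] at hmm h1 ⊢
    congr 1
    have : m i + 1 ≡ m j + 1 [MOD len (s j)] := hmm
    have := Nat.ModEq.add_right_cancel' 1 this
    rwa [Nat.ModEq, Nat.mod_eq_of_lt h1, Nat.mod_eq_of_lt h2] at this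
  refine ⟨Equiv.ofBijective f (Finite.injective_iff_bijective.1 hf), fun i => ?_⟩
  show R i.1 (c (s i) ((m i + 1) % len (s i)))
  rw [hnext _ _ (hm i)]
  have := (hc (s i)).2.2 _ (hm i)
  rwa [hcm] at this

/-- A cover of the critical graph of order `ℓ` gives a permutation of `C^ℓ` along its arcs. -/
theorem CritGraphHasCover.exists_perm (hA : IsIrreducible A) {m : ℕ} (hm : m < numCrit A)
    (h : CritGraphHasCover A (m + 1)) : ∃ σ : Equiv.Perm {i // i ∈ cumSet A (m + 1)},
      ∀ i, arcsOf (IsCriticalCircuitOfOrder A (m + 1)) i.1 (σ i).1 := by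
  have h' := HasDisjointCircuitCover.exists_perm h (by
    rintro i j ⟨k, c, hc, p, hp, rfl, rfl⟩
    simp only [nodesOf, Finset.mem_filter, Finset.mem_univ, true_and]
    exact ⟨k, c, hc, p, hp, rfl⟩)
  rwa [nodesOf_critical hA hm] at h'

/-! ### Genericity -/

theorem Generically.mono {P Q : Matrix ι ι ℂ → Prop} (h : Generically P) (hPQ : ∀ a, P a → Q a) :
    Generically Q := by
  obtain ⟨q, h0, hq⟩ := h
  exact ⟨q, h0, fun a ha => hq a fun h => ha (hPQ a h)⟩

theorem Generically.and {P Q : Matrix ι ι ℂ → Prop} (h : Generically P) (h' : Generically Q) :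
    Generically fun a => P a ∧ Q a := by
  obtain ⟨q, h0, hq⟩ := h
  obtain ⟨q', h0', hq'⟩ := h'
  refine ⟨q * q', mul_ne_zero h0 h0', fun a ha => ?_⟩
  rw [map_mul]
  by_cases hP : P a
  · rw [hq' a fun h => ha ⟨hP, h⟩, mul_zero]
  · rw [hq a hP, zero_mul]

/-- The polynomial is the determinant with indeterminates on the arcs; it is non-zero since its
value at the permutation matrix of `σ` is the sign of `σ`. -/
theorem generically_isUnit_block {G : ι → ι → Prop} {W : Finset ι} (σ : Equiv.Perm {i // i ∈ W})
    (hσ : ∀ i, G i.1 (σ i).1) :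
    Generically fun a => IsUnit ((maskMat G a).toBlock (· ∈ W) (· ∈ W)) := by
  classical
  let q : Matrix {i // i ∈ W} {i // i ∈ W} (MvPolynomial (ι × ι) ℂ) :=
    Matrix.of fun i j => if G i.1 j.1 then MvPolynomial.X (i.1, j.1) else 0
  have hq : ∀ a : Matrix ι ι ℂ, MvPolynomial.eval (fun p => a p.1 p.2) q.det =
      ((maskMat G a).toBlock (· ∈ W) (· ∈ W)).det := by
    intro a
    rw [RingHom.map_det]
    congr 1
    ext i j
    by_cases h : G i.1 j.1 <;> simp [q, maskMat, Matrix.toBlock_apply, h]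
  refine ⟨q.det, fun h0 => ?_, fun a ha => ?_⟩
  · let a : Matrix ι ι ℂ := Matrix.of fun i j => if ∃ h : i ∈ W, (σ ⟨i, h⟩).1 = j then 1 else 0
    have h1 := hq a
    have h2 : (maskMat G a).toBlock (· ∈ W) (· ∈ W) = σ.permMatrix ℂ := by
      ext ⟨i, hi⟩ ⟨j, hj⟩
      by_cases h : σ ⟨i, hi⟩ = ⟨j, hj⟩
      · have hG := hσ ⟨i, hi⟩
        rw [h] at hG
        simp [maskMat, Matrix.toBlock_apply, hG, a, hi, h, Equiv.Perm.permMatrix, PEquiv.toMatrix_apply]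
      · have h' : ¬ (σ ⟨i, hi⟩).1 = j := fun h' => h (Subtype.ext h')
        simp [maskMat, Matrix.toBlock_apply, a, hi, h, h', Equiv.Perm.permMatrix, PEquiv.toMatrix_apply]
    rw [h0, h2, Matrix.det_permutation, map_zero] at h1
    exact (Int.cast_ne_zero.2 (Units.ne_zero (Equiv.Perm.sign σ))) h1.symm
  · rw [hq]
    by_contra h
    exact ha ((Matrix.isUnit_iff_isUnit_det _).2 (isUnit_iff_ne_zero.2 h))

/-! ### Conventional Schur complements -/

theorem det_block_union {C K W : Finset ι} (hW : W = C ∪ K)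
    (b : Matrix ι ι ℂ) (hb : IsUnit (b.toBlock (· ∈ C) (· ∈ C))) :
    (b.toBlock (· ∈ W) (· ∈ W)).det = (b.toBlock (· ∈ C) (· ∈ C)).det *
      ((schur C b).toBlock (fun i => i.1 ∈ K) (fun i => i.1 ∈ K)).det := by
  subst hW
  let f : {i // i ∈ C} ⊕ {i : {i // i ∉ C} // i.1 ∈ K} → {i // i ∈ C ∪ K} :=
    Sum.elim (fun i => ⟨i.1, Finset.mem_union_left _ i.2⟩)
      (fun i => ⟨i.1.1, Finset.mem_union_right _ i.2⟩)
  have hf : Function.Bijective f := by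
    constructor
    · rintro (⟨i, hi⟩ | ⟨⟨i, hi⟩, hi'⟩) (⟨j, hj⟩ | ⟨⟨j, hj⟩, hj'⟩) h <;>
        simp only [f, Sum.elim_inl, Sum.elim_inr, Subtype.mk.injEq] at h <;> subst h
      · rfl
      · exact absurd hi hj
      · exact absurd hj hi
      · rfl
    · rintro ⟨i, hi⟩
      by_cases h : i ∈ C
      · exact ⟨Sum.inl ⟨i, h⟩, rfl⟩
      · exact ⟨Sum.inr ⟨⟨i, h⟩, (Finset.mem_union.1 hi).resolve_left h⟩, rfl⟩
  let := hb.invertible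
  rw [← Matrix.det_submatrix_equiv_self (Equiv.ofBijective f hf)]
  have : (b.toBlock (· ∈ C ∪ K) (· ∈ C ∪ K)).submatrix (Equiv.ofBijective f hf)
      (Equiv.ofBijective f hf) = Matrix.fromBlocks (b.toBlock (· ∈ C) (· ∈ C))
        (Matrix.of fun i j => b i.1 j.1.1) (Matrix.of fun i j => b i.1.1 j.1)
        (Matrix.of fun i j => b i.1.1 j.1.1) := by
    ext (i | i) (j | j) <;> rfl
  rw [this, Matrix.det_fromBlocks₁₁, Matrix.invOf_eq_nonsing_inv]
  rfl

/-- The variable `z` is absent from the `C` block, so the Schur complement is still affine in `z`.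
-/
theorem schur_pencil (C : Finset ι) (b : Matrix ι ι ℂ) (hb : IsUnit (b.toBlock (· ∈ C) (· ∈ C)))
    (z : ℂ) :
    schur C (Matrix.diagonal (fun i => if i ∈ C then 0 else z) - b) =
      Matrix.scalar _ z - schur C b := by
  set X := Matrix.diagonal (fun i => if i ∈ C then 0 else z) - b
  have h1 : X.toBlock (· ∈ C) (· ∈ C) = -b.toBlock (· ∈ C) (· ∈ C) := by
    ext i j
    simp [X, Matrix.toBlock_apply, Matrix.diagonal_apply, i.2]
  have h2 : X.toBlock (· ∉ C) (· ∈ C) = -b.toBlock (· ∉ C) (· ∈ C) := by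
    ext i j
    have : i.1 ≠ j.1 := fun h => i.2 (h ▸ j.2)
    simp [X, Matrix.toBlock_apply, this]
  have h3 : X.toBlock (· ∈ C) (· ∉ C) = -b.toBlock (· ∈ C) (· ∉ C) := by
    ext i j
    simp [X, Matrix.toBlock_apply, Matrix.diagonal_apply, i.2]
  have h4 : X.toBlock (· ∉ C) (· ∉ C) = Matrix.scalar _ z - b.toBlock (· ∉ C) (· ∉ C) := by
    ext i j
    simp [X, Matrix.toBlock_apply, Matrix.diagonal_apply, i.2, Subtype.ext_iff]
  have h5 : (-b.toBlock (· ∈ C) (· ∈ C))⁻¹ = -(b.toBlock (· ∈ C) (· ∈ C))⁻¹ := by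
    refine Matrix.inv_eq_right_inv ?_
    rw [neg_mul_neg, Matrix.mul_nonsing_inv _ ((Matrix.isUnit_iff_isUnit_det _).1 hb)]
  rw [schur, schur, h1, h2, h3, h4, h5]
  simp only [Matrix.neg_mul, Matrix.mul_neg, neg_neg]
  abel

/-- If no circuit of the graph of `X` visits a node outside of `p`, these nodes
contribute to the determinant by their diagonal entries. -/
theorem det_eq_of_no_circuit (X : Matrix ι ι ℂ) (R : ι → ι → Prop) (p : ι → Prop) [DecidablePred p]
    (hX : ∀ i j, i ≠ j → X i j ≠ 0 → R i j) (hR : ∀ i, ¬ p i → ¬ Relation.TransGen R i i) :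
    X.det = (X.toBlock p p).det * ∏ i : {i // ¬ p i}, X i.1 i.1 := by
  classical
  -- Rows outside `p` are cut down to their diagonal entry. No non-zero term of the Leibniz
  -- expansion is lost.
  set Y : Matrix ι ι ℂ := Matrix.of fun i j => if ¬ p i ∧ i ≠ j then 0 else X i j with hY
  have hdet : X.det = Y.det := by
    rw [Matrix.det_apply, Matrix.det_apply]
    refine Finset.sum_congr rfl fun π _ => ?_
    congr 1
    by_cases hπ : ∃ i, ¬ p i ∧ π i ≠ i
    · obtain ⟨i, hi, hπi⟩ := hπ
      have hYz : ∏ k, Y (π k) k = 0 := by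
        refine Finset.prod_eq_zero (Finset.mem_univ (π.symm i)) ?_
        have : i ≠ π.symm i := fun h => hπi (by
          conv_lhs => rw [h]
          simp)
        simp [hY, hi, this]
      rw [hYz]
      by_contra hne
      have hne' : ∀ k, X (π k) k ≠ 0 := fun k => Finset.prod_ne_zero_iff.1 hne k (Finset.mem_univ k)
      -- A non-zero term that moves `i` yields arcs from `π k` to `k` along the orbit of `i`; after
      -- `orderOf π` steps they close up at `i`.
      have hpow : ∀ n : ℕ, Relation.TransGen R ((π ^ (n + 1)) i) i := by
        intro n
        induction n with
        | zero => exact .single (hX _ _ (by simpa using hπi) (by simpa using hne' i))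
        | succ n ih =>
          refine Relation.TransGen.head (hX _ _ ?_ ?_) ih
          · rw [pow_succ' π (n + 1), Equiv.Perm.mul_apply]
            intro h
            apply hπi
            apply (π ^ (n + 1)).injective
            rw [← Equiv.Perm.mul_apply, ← pow_succ, pow_succ', Equiv.Perm.mul_apply, h]
          · rw [pow_succ' π (n + 1), Equiv.Perm.mul_apply]
            exact hne' _
      obtain ⟨n, hn⟩ := Nat.exists_eq_add_of_le' (orderOf_pos π)
      have := hpow n
      rw [show n + 1 = orderOf π by omega, pow_orderOf_eq_one] at this
      exact hR i hi this
    · push Not at hπ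
      refine Finset.prod_congr rfl fun k _ => ?_
      have : ¬ (¬ p (π k) ∧ π k ≠ k) := fun h => h.2 (π.injective (hπ _ h.1))
      simp only [hY, Matrix.of_apply, if_neg this]
  rw [hdet, Matrix.twoBlockTriangular_det Y p fun i hi j hj => by
    have : i ≠ j := by rintro rfl; exact hi hj
    simp [hY, hi, this]]
  congr 1
  · congr 1
    ext i j
    simp [hY, Matrix.toSquareBlockProp, Matrix.toBlock_apply, i.2]
  · rw [← Matrix.det_diagonal]
    congr 1
    ext i j
    by_cases h : i = j
    · subst h
      simp [hY, Matrix.toSquareBlockProp]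
    · have : i.1 ≠ j.1 := fun h' => h (Subtype.ext h')
      simp [hY, Matrix.toSquareBlockProp, i.2, this, h]

/-- Generic invertibility of `r^ℓ` and `t^ℓ` for graphs that contain the critical graph. -/
theorem generically_isUnit (hA : IsIrreducible A) {m : ℕ} (hm : m < numCrit A)
    (h : CritGraphHasCover A m) (h' : CritGraphHasCover A (m + 1)) {G : ι → ι → Prop}
    (hG : ∀ i j, arcsOf (IsCriticalCircuitOfOrder A (m + 1)) i j → G i j) :
    Generically fun a => IsUnit (rMat A G a (m + 1)) ∧ IsUnit (tMat A G a (m + 1)) := by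
  obtain ⟨σ, hσ⟩ : ∃ σ : Equiv.Perm {i // i ∈ cumSet A m}, ∀ i, G i.1 (σ i).1 := by
    cases m with
    | zero => exact ⟨1, fun i => absurd i.2 (by simp [cumSet_zero])⟩
    | succ m =>
      obtain ⟨σ, hσ⟩ := h.exists_perm hA (by omega)
      refine ⟨σ, fun i => hG _ _ ?_⟩
      obtain ⟨k, c, hc, hp⟩ := hσ i
      exact ⟨k, c, hc.mono hA (by omega) hm, hp⟩
  obtain ⟨σ', hσ'⟩ := h'.exists_perm hA hm
  refine ((generically_isUnit_block σ hσ).and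
    (generically_isUnit_block σ' fun i => hG _ _ (hσ' i))).mono fun a ⟨ha, ha'⟩ => ⟨ha, ?_⟩
  have := det_block_union (cumSet_succ m) _ ha
  rw [Matrix.isUnit_iff_isUnit_det, this] at ha'
  exact (Matrix.isUnit_iff_isUnit_det _).2 (isUnit_of_mul_isUnit_right ha')

/-! ### Limits in the Riemann sphere -/

theorem tendsto_coe_coe {α : Type*} {l : Filter α} {f : α → ℂ} {a : ℂ} :
    Tendsto (fun e => (f e : OnePoint ℂ)) l (𝓝 (a : OnePoint ℂ)) ↔ Tendsto f l (𝓝 a) :=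
  (OnePoint.isOpenEmbedding_coe.tendsto_nhds_iff (f := f)).symm

theorem tendsto_coe_infty_iff {α : Type*} {l : Filter α} {f : α → ℂ} :
    Tendsto (fun e => (f e : OnePoint ℂ)) l (𝓝 OnePoint.infty) ↔
      Tendsto (fun e => ‖f e‖) l atTop := by
  rw [tendsto_norm_atTop_iff_cobounded, Metric.cobounded_eq_cocompact,
    ← coclosedCompact_eq_cocompact, ← OnePoint.comap_coe_nhds_infty, tendsto_comap_iff]
  rfl

/-- Compactness of the Riemann sphere. -/
theorem exists_tendsto_ultrafilter {α : Type*} (U : Ultrafilter α) (f : α → ℂ) :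
    ∃ x : OnePoint ℂ, Tendsto (fun e => (f e : OnePoint ℂ)) U (𝓝 x) :=
  ⟨_, (U.map fun e => (f e : OnePoint ℂ)).le_nhds_lim⟩

/-- The number of members of the family `L` that are equal to `a` is the multiplicity of `a` as a
root of `P`. -/
def IsRootFamily (P : Polynomial ℂ) (L : ι → OnePoint ℂ) : Prop :=
  ∀ a : ℂ, Nat.card {i // L i = a} = P.rootMultiplicity a

open Polynomial in
/-- The limits along an ultrafilter of the roots of a converging family of polynomials. -/
theorem isRootFamily_of_tendsto {α : Type*} {U : Ultrafilter α} {w : ι → α → ℂ} {κ : α → ℂ}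
    {P : Polynomial ℂ} (hP0 : P ≠ 0)
    (hP : ∀ z, Tendsto (fun e => κ e * ∏ i, (z - w i e)) U (𝓝 (P.eval z)))
    {L : ι → OnePoint ℂ} (hL : ∀ i, Tendsto (fun e => (w i e : OnePoint ℂ)) U (𝓝 (L i))) :
    IsRootFamily P L := by
  classical
  -- Factors are normalised one by one: a root with finite limit `b` gives `X - b` with `s = 1`, and
  -- a root going to infinity gives the constant `1` with `s = -1 / w`.
  have hfac : ∀ i, ∃ (s : α → ℂ) (q : ℂ[X]), (∀ᶠ e in (U : Filter α), s e ≠ 0) ∧ q ≠ 0 ∧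
      (∀ z, Tendsto (fun e => (z - w i e) * s e) U (𝓝 (q.eval z))) ∧
      ∀ a : ℂ, q.roots.count a = if L i = a then 1 else 0 := by
    intro i
    have hi := hL i
    induction hx : L i using OnePoint.rec with
    | infty =>
      rw [hx, tendsto_coe_infty_iff] at hi
      have hne : ∀ᶠ e in (U : Filter α), w i e ≠ 0 :=
        (hi.eventually_gt_atTop 0).mono fun e he => norm_pos_iff.1 he
      refine ⟨fun e => -(w i e)⁻¹, 1, hne.mono fun e he => by simpa using he, one_ne_zero,
        fun z => ?_, fun a => by simp⟩
      have h0 : Tendsto (fun e => (w i e)⁻¹) U (𝓝 0) :=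
        tendsto_inv₀_cobounded.comp (tendsto_norm_atTop_iff_cobounded.1 hi)
      have h1 : Tendsto (fun e => 1 - z * (w i e)⁻¹) U (𝓝 (1 - z * 0)) :=
        tendsto_const_nhds.sub (tendsto_const_nhds.mul h0)
      rw [mul_zero, sub_zero] at h1
      rw [eval_one]
      refine h1.congr' (hne.mono fun e he => ?_)
      field_simp
      ring
    | coe b =>
      rw [hx, tendsto_coe_coe] at hi
      refine ⟨fun _ => 1, X - C b, by simp, X_sub_C_ne_zero b, fun z => ?_, fun a => ?_⟩
      · simpa using tendsto_const_nhds.sub hi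
      · rw [roots_X_sub_C, Multiset.count_singleton]
        simp [eq_comm]
  choose s q hs hq hlim hroots using hfac
  set Q : ℂ[X] := ∏ i, q i
  have hQ0 : Q ≠ 0 := Finset.prod_ne_zero_iff.2 fun i _ => hq i
  have hQ : ∀ z, Tendsto (fun e => ∏ i, ((z - w i e) * s i e)) U (𝓝 (Q.eval z)) := fun z => by
    rw [eval_prod]
    exact tendsto_finsetProd _ fun i _ => hlim i z
  obtain ⟨z₀, hz₀⟩ : ∃ z, (P * Q).eval z ≠ 0 := by
    by_contra! hcon
    exact mul_ne_zero hP0 hQ0 (Polynomial.funext fun z => by rw [hcon z, eval_zero])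
  rw [eval_mul] at hz₀
  have hzP := left_ne_zero_of_mul hz₀
  have hzQ := right_ne_zero_of_mul hz₀
  have hsall : ∀ᶠ e in (U : Filter α), ∀ i, s i e ≠ 0 := eventually_all.2 hs
  -- Evaluating at one point where neither limit vanishes gives the limit of the remaining scalar
  -- factor. Hence `P` is a constant multiple of `Q`.
  have hκ : Tendsto (fun e => κ e / ∏ i, s i e) U (𝓝 (P.eval z₀ / Q.eval z₀)) := by
    refine ((hP z₀).div (hQ z₀) hzQ).congr' ?_
    filter_upwards [hsall, (hQ z₀).eventually_ne hzQ] with e he hne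
    simp only [Pi.div_apply]
    rw [Finset.prod_mul_distrib] at hne ⊢
    have h1 := left_ne_zero_of_mul hne
    have h2 := right_ne_zero_of_mul hne
    field_simp
  have hPQ : P = C (P.eval z₀ / Q.eval z₀) * Q := by
    refine Polynomial.funext fun z => ?_
    rw [eval_mul, eval_C]
    refine tendsto_nhds_unique (hP z) ((hκ.mul (hQ z)).congr' ?_)
    filter_upwards [hsall] with e he
    rw [Finset.prod_mul_distrib]
    have : ∏ i, s i e ≠ 0 := Finset.prod_ne_zero_iff.2 fun i _ => he i
    field_simp
  intro a
  rw [hPQ, ← count_roots, roots_C_mul _ (div_ne_zero hzP hzQ), roots_prod _ _ hQ0,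
    Multiset.count_bind, Nat.card_eq_fintype_card, Fintype.card_subtype, Finset.card_filter]
  exact Finset.sum_congr rfl fun i _ => (hroots i a).symm

theorem IsRootFamily.card_ne_infty {P : Polynomial ℂ} {L : ι → OnePoint ℂ} (h : IsRootFamily P L) :
    Nat.card {i // L i ≠ OnePoint.infty} = P.natDegree := by
  classical
  -- By convention the zero polynomial has all root multiplicities and its degree equal to `0`.
  by_cases hP : P = 0
  · subst hP
    have : IsEmpty {i // L i ≠ OnePoint.infty} := ⟨fun ⟨i, hi⟩ => by
      obtain ⟨a, ha⟩ := OnePoint.ne_infty_iff_exists.1 hi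
      have := h a
      rw [Polynomial.rootMultiplicity_zero, Finite.card_eq_zero_iff] at this
      exact this.elim ⟨i, ha.symm⟩⟩
    simp
  have hcard := IsAlgClosed.card_roots_eq_natDegree (p := P)
  rw [← hcard, ← Multiset.toFinset_sum_count_eq, Nat.card_eq_fintype_card, Fintype.card_subtype,
    Finset.card_eq_sum_card_fiberwise (f := L) (t := P.roots.toFinset.image ((↑) : ℂ → OnePoint ℂ))]
  · rw [Finset.sum_image fun a _ b _ hab => OnePoint.coe_injective hab]
    refine Finset.sum_congr rfl fun a _ => ?_
    rw [Polynomial.count_roots, ← h a, Nat.card_eq_fintype_card, Fintype.card_subtype,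
      Finset.filter_filter]
    congr 1
    ext i
    simp only [Finset.mem_filter, Finset.mem_univ, true_and, and_iff_right_iff_imp]
    intro hi
    rw [hi]
    exact OnePoint.coe_ne_infty a
  · intro i hi
    obtain ⟨a, ha⟩ := OnePoint.ne_infty_iff_exists.1 (Finset.mem_filter.1 hi).2
    refine Finset.mem_coe.2 (Finset.mem_image.2 ⟨a, ?_, ha⟩)
    rw [Multiset.mem_toFinset, ← Multiset.count_pos, Polynomial.count_roots, ← h a,
      Finite.card_pos_iff]
    exact ⟨⟨i, ha.symm⟩⟩

theorem card_subtype_add_card_not (p : ι → Prop) :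
    Nat.card {i // p i} + Nat.card {i // ¬ p i} = Fintype.card ι := by
  classical
  rw [Nat.card_eq_fintype_card, Nat.card_eq_fintype_card, Fintype.card_subtype_compl]
  have := Fintype.card_subtype_le p
  omega

/-- Two families of roots differ by a permutation. -/
theorem IsRootFamily.exists_perm {P : Polynomial ℂ} {L L' : ι → OnePoint ℂ}
    (h : IsRootFamily P L) (h' : IsRootFamily P L') : ∃ σ : Equiv.Perm ι, ∀ i, L' (σ i) = L i := by
  have hcard : ∀ x, Nat.card {i // L i = x} = Nat.card {i // L' i = x} := by
    intro x
    induction x using OnePoint.rec with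
    | infty =>
      have h1 := h.card_ne_infty
      have h2 := h'.card_ne_infty
      have h3 := card_subtype_add_card_not fun i => L i = OnePoint.infty
      have h4 := card_subtype_add_card_not fun i => L' i = OnePoint.infty
      simp only [ne_eq] at h1 h2
      omega
    | coe a => rw [h a, h' a]
  exact ⟨Equiv.ofFiberEquiv fun x => (Finite.equivFinOfCardEq (hcard x)).trans (Finite.equivFin _).symm,
    fun i => Equiv.ofFiberEquiv_map _ i⟩

/-- The distance of a complex number to a point of the Riemann sphere. -/
noncomputable def cost (x : OnePoint ℂ) (w : ℂ) : ℝ :=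
  x.elim (1 + ‖w‖)⁻¹ (fun a => ‖w - a‖)

theorem cost_nonneg (x : OnePoint ℂ) (w : ℂ) : 0 ≤ cost x w := by
  induction x using OnePoint.rec with
  | infty => exact inv_nonneg.2 (by positivity)
  | coe a => exact norm_nonneg _

theorem tendsto_cost {α : Type*} {l : Filter α} {f : α → ℂ} {x : OnePoint ℂ} :
    Tendsto (fun e => cost x (f e)) l (𝓝 0) ↔ Tendsto (fun e => (f e : OnePoint ℂ)) l (𝓝 x) := by
  induction x using OnePoint.rec with
  | infty =>
    rw [tendsto_coe_infty_iff]
    show Tendsto (fun e => (1 + ‖f e‖)⁻¹) l (𝓝 0) ↔ _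
    constructor
    · intro h
      have h1 : Tendsto (fun e => (1 + ‖f e‖)⁻¹) l (𝓝[>] 0) :=
        tendsto_nhdsWithin_iff.2 ⟨h, Eventually.of_forall fun e => Set.mem_Ioi.2 (by positivity)⟩
      have h2 := tendsto_inv_nhdsGT_zero.comp h1
      simp only [Function.comp_def, inv_inv] at h2
      simpa using tendsto_atTop_add_const_left l (-1) h2
    · intro h
      exact tendsto_inv_atTop_zero.comp (tendsto_atTop_add_const_left l 1 h)
  | coe a =>
    rw [tendsto_coe_coe]
    exact (tendsto_iff_norm_sub_tendsto_zero (f := f) (b := a)).symm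

/-- The roots of a converging family of polynomials can be sorted so that they converge. -/
theorem exists_sorted_roots {α : Type*} {l : Filter α} [l.NeBot] {w : ι → α → ℂ} {κ : α → ℂ}
    {P : Polynomial ℂ} (hP0 : P ≠ 0)
    (hP : ∀ z, Tendsto (fun e => κ e * ∏ i, (z - w i e)) l (𝓝 (P.eval z))) :
    ∃ L : ι → OnePoint ℂ, IsRootFamily P L ∧ ∃ σ : α → Equiv.Perm ι,
      ∀ i, Tendsto (fun e => (w (σ e i) e : OnePoint ℂ)) l (𝓝 (L i)) := by
  choose L hL using fun i => exists_tendsto_ultrafilter (Ultrafilter.of l) (w i)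
  have hLr := isRootFamily_of_tendsto hP0
    (fun z => (hP z).mono_left (Ultrafilter.of_le l)) hL
  refine ⟨L, hLr, ?_⟩
  -- At each parameter the roots are matched with `L` at least total cost. Along any ultrafilter
  -- some fixed permutation has cost tending to zero, so the least cost tends to zero.
  choose σ hσ using fun e => Finite.exists_min
    (fun σ : Equiv.Perm ι => ∑ i, cost (L i) (w (σ i) e))
  refine ⟨σ, fun i => tendsto_cost.1 ?_⟩
  have htot : Tendsto (fun e => ∑ i, cost (L i) (w (σ e i) e)) l (𝓝 0) := by
    refine (tendsto_iff_ultrafilter _ _ _).2 fun U hU => ?_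
    choose L' hL' using fun i => exists_tendsto_ultrafilter U (w i)
    obtain ⟨τ, hτ⟩ := hLr.exists_perm
      (isRootFamily_of_tendsto hP0 (fun z => (hP z).mono_left hU) hL')
    have h1 : Tendsto (fun e => ∑ i, cost (L i) (w (τ i) e)) U (𝓝 0) := by
      have := tendsto_finsetSum Finset.univ
        (fun i _ => tendsto_cost.2 (hτ i ▸ hL' (τ i)) :
          ∀ i ∈ (Finset.univ : Finset ι), Tendsto (fun e => cost (L i) (w (τ i) e)) U (𝓝 0))
      simpa using this
    exact squeeze_zero (fun e => Finset.sum_nonneg fun i _ => cost_nonneg _ _)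
      (fun e => hσ e τ) h1
  exact squeeze_zero (fun e => cost_nonneg _ _)
    (fun e => Finset.single_le_sum (f := fun i => cost (L i) (w (σ e i) e))
      (fun i _ => cost_nonneg _ _) (Finset.mem_univ i)) htot

/-- A continuous function with finitely many limit points in the Riemann sphere converges. -/
theorem exists_tendsto_of_continuousOn {f : ℝ → ℂ} {e₀ : ℝ} (he₀ : 0 < e₀)
    (hf : ContinuousOn f (Set.Ioo 0 e₀)) {F : Set (OnePoint ℂ)} (hF : F.Finite)
    (hlim : ∀ (U : Ultrafilter ℝ) (x : OnePoint ℂ), ↑U ≤ 𝓝[>] (0 : ℝ) →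
      Tendsto (fun e => (f e : OnePoint ℂ)) U (𝓝 x) → x ∈ F) :
    ∃ x : OnePoint ℂ, Tendsto (fun e => (f e : OnePoint ℂ)) (𝓝[>] 0) (𝓝 x) := by
  obtain ⟨p, hp⟩ := exists_tendsto_ultrafilter (Ultrafilter.of (𝓝[>] (0 : ℝ))) f
  refine ⟨p, (tendsto_iff_ultrafilter _ _ _).2 fun U hU => ?_⟩
  obtain ⟨q, hq⟩ := exists_tendsto_ultrafilter U f
  suffices q = p from this ▸ hq
  by_contra hne
  have hqF := hlim U q hU hq
  -- Separate `p` from the other possible limits. Near `0` the values lie in `O ∪ O'`, and two limit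
  -- points would make the connected image of a short interval meet both.
  obtain ⟨O, O', hO, hO', hpO, hFO', hdisj⟩ := SeparatedNhds.of_isCompact_isCompact
    (isCompact_singleton (x := p)) (hF.subset (Set.sdiff_subset (s := F) (t := {p}))).isCompact
    Set.disjoint_sdiff_right
  have hcov : ∀ᶠ e in 𝓝[>] (0 : ℝ), (f e : OnePoint ℂ) ∈ O ∪ O' := by
    refine mem_iff_ultrafilter.2 fun W hW => ?_
    obtain ⟨x, hx⟩ := exists_tendsto_ultrafilter W f
    refine hx.eventually ((hO.union hO').mem_nhds ?_)
    by_cases hxp : x = p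
    · exact Or.inl (hpO hxp)
    · exact Or.inr (hFO' ⟨hlim W x hW hx, hxp⟩)
  obtain ⟨δ, hδ, hsub⟩ := mem_nhdsGT_iff_exists_Ioo_subset.1
    (inter_mem hcov (Ioo_mem_nhdsGT he₀))
  have hconn : IsPreconnected ((fun e => (f e : OnePoint ℂ)) '' Set.Ioo 0 δ) :=
    isPreconnected_Ioo.image _ (OnePoint.continuous_coe.comp_continuousOn
      (hf.mono fun e he => (hsub he).2))
  have hδmem : Set.Ioo 0 δ ∈ 𝓝[>] (0 : ℝ) := Ioo_mem_nhdsGT hδ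
  obtain ⟨e₁, h₁, h₁'⟩ := ((hp.eventually (hO.mem_nhds (hpO rfl))).and
    (Ultrafilter.of_le (𝓝[>] (0 : ℝ)) hδmem)).exists
  obtain ⟨e₂, h₂, h₂'⟩ := ((hq.eventually (hO'.mem_nhds (hFO' ⟨hqF, hne⟩))).and
    (hU hδmem)).exists
  have hmeet : ((fun e => (f e : OnePoint ℂ)) '' Set.Ioo 0 δ ∩ O).Nonempty :=
    ⟨f e₁, ⟨e₁, h₁', rfl⟩, h₁⟩
  have hsubset : (fun e => (f e : OnePoint ℂ)) '' Set.Ioo 0 δ ⊆ O ∪ O' := by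
    rintro _ ⟨e, he, rfl⟩
    exact (hsub he).1
  have hall := hconn.subset_left_of_subset_union hO hO' hdisj hsubset hmeet
  exact Set.disjoint_left.1 hdisj (hall ⟨e₂, h₂', rfl⟩) h₂

/-! ### Counting eigenvalues -/

theorem exists_enumeration {s : Multiset ℂ} (hs : Multiset.card s = Fintype.card ι) :
    ∃ f : ι → ℂ, s = Finset.univ.val.map f := by
  let g : ι ≃ Fin s.toList.length := (Fintype.equivFinOfCardEq (by simpa using hs.symm))
  refine ⟨fun i => s.toList.get (g i), ?_⟩
  have h1 : Finset.univ.val.map g = (Finset.univ : Finset (Fin s.toList.length)).val :=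
    Multiset.map_univ_val_equiv g
  have h2 : (Finset.univ.val.map fun i => s.toList.get (g i)) =
      (Finset.univ.val.map g).map s.toList.get := by rw [Multiset.map_map]; rfl
  rw [h2, h1, Fin.univ_val_map, List.ofFn_get, Multiset.coe_toList]

theorem hasEquivalent_iff {f : ℝ → ℂ} {x : ℝ} {y : OnePoint ℂ}
    (h : Tendsto (fun e : ℝ => ((((e ^ (-x) : ℝ) : ℂ) * f e : ℂ) : OnePoint ℂ)) (𝓝[>] 0) (𝓝 y)) :
    HasEquivalent f x ↔ y ≠ OnePoint.infty ∧ y ≠ (0 : ℂ) := by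
  constructor
  · rintro ⟨z, hz, h'⟩
    obtain rfl := tendsto_nhds_unique h (tendsto_coe_coe.2 h')
    exact ⟨OnePoint.coe_ne_infty z, fun h => hz (OnePoint.coe_injective h)⟩
  · rintro ⟨h1, h2⟩
    obtain ⟨z, rfl⟩ := OnePoint.ne_infty_iff_exists.1 h1
    exact ⟨z, fun hz => h2 (hz ▸ rfl), tendsto_coe_coe.1 h⟩

/-- If the characteristic polynomials of `M ε`, rescaled by `ε^x`, converge up to normalisation to
a non-zero multiple of `X^t χ`, where `0` is not a root of `χ`, then `deg χ` eigenvalues have an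
equivalent of the form `z ε^x`. -/
theorem equivalentCount_of_tendsto {M : ℝ → Matrix ι ι ℂ} {x : ℝ} {κ : ℝ → ℂ} {c : ℂ} {t : ℕ}
    {χ : Polynomial ℂ} (hc : c ≠ 0) (hχ : χ.eval 0 ≠ 0)
    (hlim : ∀ z : ℂ, Tendsto (fun e : ℝ => κ e * (M e).charpoly.eval (((e ^ x : ℝ) : ℂ) * z))
      (𝓝[>] 0) (𝓝 (c * z ^ t * χ.eval z))) : EquivalentCount M x χ.natDegree := by
  classical
  have hχ0 : χ ≠ 0 := by rintro rfl; simp at hχ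
  set P : Polynomial ℂ := Polynomial.C c * Polynomial.X ^ t * χ with hPdef
  have hCX : Polynomial.C c * Polynomial.X ^ t ≠ 0 :=
    mul_ne_zero (Polynomial.C_ne_zero.2 hc) (pow_ne_zero _ Polynomial.X_ne_zero)
  have hP0 : P ≠ 0 := mul_ne_zero hCX hχ0
  have hdeg : P.natDegree = t + χ.natDegree := by
    rw [hPdef, Polynomial.natDegree_mul hCX hχ0, Polynomial.natDegree_C_mul_X_pow _ _ hc]
  have hmult : P.rootMultiplicity 0 = t := by
    rw [hPdef, Polynomial.rootMultiplicity_mul hP0,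
      Polynomial.rootMultiplicity_eq_zero (p := χ) (x := 0) hχ, add_zero,
      Polynomial.rootMultiplicity_mul hCX, Polynomial.rootMultiplicity_C, zero_add]
    simpa using Polynomial.rootMultiplicity_X_sub_C_pow (0 : ℂ) t
  -- Factor `ε^x` out of each of the `n` linear factors of the characteristic polynomial.
  have hscaled : ∀ Y : ι → ℝ → ℂ, EnumeratesEigenvalues M Y → ∀ z : ℂ,
      Tendsto (fun e : ℝ => (κ e * ((e ^ x : ℝ) : ℂ) ^ Fintype.card ι) *
        ∏ i, (z - ((e ^ (-x) : ℝ) : ℂ) * Y i e)) (𝓝[>] 0) (𝓝 (P.eval z)) := by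
    intro Y hY z
    have h1 : P.eval z = c * z ^ t * χ.eval z := by simp [hPdef]
    rw [h1]
    refine (hlim z).congr' ?_
    filter_upwards [hY, self_mem_nhdsWithin] with e he hpos
    rw [(IsAlgClosed.splits _).eval_eq_prod_roots_of_monic (Matrix.charpoly_monic (M e)), he,
      Multiset.map_map, mul_assoc]
    congr 1
    have hx : ((e ^ x : ℝ) : ℂ) * ((e ^ (-x) : ℝ) : ℂ) = 1 := by
      rw [← Complex.ofReal_mul, ← Real.rpow_add hpos, add_neg_cancel, Real.rpow_zero,
        Complex.ofReal_one]
    rw [← Finset.card_univ, ← Finset.prod_const, ← Finset.prod_mul_distrib]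
    refine Finset.prod_congr rfl fun i _ => ?_
    rw [mul_sub, ← mul_assoc, hx, one_mul]
    rfl
  have hcount : ∀ (Y : ι → ℝ → ℂ) (L : ι → OnePoint ℂ), IsRootFamily P L →
      (∀ i, Tendsto (fun e : ℝ => ((((e ^ (-x) : ℝ) : ℂ) * Y i e : ℂ) : OnePoint ℂ))
        (𝓝[>] 0) (𝓝 (L i))) → {i | HasEquivalent (Y i) x}.ncard = χ.natDegree := by
    intro Y L hL hY
    -- There are `deg P = t + deg χ` finite limits, of which `t` are zero.
    have h1 : {i | HasEquivalent (Y i) x} =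
        {i | L i ≠ OnePoint.infty} \ {i | L i = ((0 : ℂ) : OnePoint ℂ)} := by
      ext i
      exact hasEquivalent_iff (hY i)
    have h2 : {i | L i = ((0 : ℂ) : OnePoint ℂ)} ⊆ {i | L i ≠ OnePoint.infty} := by
      intro i hi
      rw [Set.mem_ofPred_eq] at hi ⊢
      rw [hi]
      exact OnePoint.coe_ne_infty _
    rw [h1, Set.ncard_sdiff h2, ← Nat.card_coe_set_eq, ← Nat.card_coe_set_eq]
    have h3 := hL.card_ne_infty
    have h4 := hL 0
    rw [hdeg] at h3
    rw [hmult] at h4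
    show Nat.card {i // L i ≠ OnePoint.infty} - Nat.card {i // L i = ((0 : ℂ) : OnePoint ℂ)} = _
    omega
  constructor
  · have hcard : ∀ e, Multiset.card (M e).charpoly.roots = Fintype.card ι := fun e => by
      rw [IsAlgClosed.card_roots_eq_natDegree, Matrix.charpoly_natDegree_eq_dim]
    choose Y₀ hY₀ using fun e => exists_enumeration (hcard e)
    obtain ⟨L, hL, σ, hσ⟩ := exists_sorted_roots hP0
      (hscaled (fun i e => Y₀ e i) (Eventually.of_forall hY₀))
    refine ⟨fun i e => Y₀ e (σ e i), Eventually.of_forall fun e => ?_, hcount _ L hL hσ,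
      fun i => ?_⟩
    · rw [hY₀ e]
      conv_lhs => rw [← Multiset.map_univ_val_equiv (σ e), Multiset.map_map]
      rfl
    · by_cases h1 : L i = OnePoint.infty
      · refine Or.inr (Or.inr ?_)
        have := hσ i
        rw [h1, tendsto_coe_infty_iff] at this
        refine this.congr' ?_
        filter_upwards [self_mem_nhdsWithin] with e he
        rw [norm_mul, Complex.norm_real, Real.norm_of_nonneg (Real.rpow_nonneg (le_of_lt he) _)]
      · by_cases h2 : L i = ((0 : ℂ) : OnePoint ℂ)
        · exact Or.inr (Or.inl (tendsto_coe_coe.1 (h2 ▸ hσ i)))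
        · exact Or.inl ((hasEquivalent_iff (hσ i)).2 ⟨h1, h2⟩)
  · intro Y hgerm hY
    have hUlim : ∀ (U : Ultrafilter ℝ), ↑U ≤ 𝓝[>] (0 : ℝ) → ∀ L : ι → OnePoint ℂ,
        (∀ i, Tendsto (fun e : ℝ => ((((e ^ (-x) : ℝ) : ℂ) * Y i e : ℂ) : OnePoint ℂ)) U
          (𝓝 (L i))) → IsRootFamily P L := fun U hU L hL =>
      isRootFamily_of_tendsto hP0 (fun z => (hscaled Y hY z).mono_left hU) hL
    -- The possible limits of a rescaled eigenvalue are infinity and the roots of `P`; continuity of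
    -- the germ then forces convergence.
    set F : Set (OnePoint ℂ) :=
      insert OnePoint.infty (((↑) : ℂ → OnePoint ℂ) '' (P.roots.toFinset : Set ℂ))
    have hF : F.Finite := (Set.Finite.image _ (Finset.finite_toSet _)).insert _
    have hconv : ∀ i, ∃ y : OnePoint ℂ,
        Tendsto (fun e : ℝ => ((((e ^ (-x) : ℝ) : ℂ) * Y i e : ℂ) : OnePoint ℂ))
          (𝓝[>] 0) (𝓝 y) := by
      intro i
      obtain ⟨e₀, he₀, hcont, -⟩ := hgerm i
      refine exists_tendsto_of_continuousOn he₀ (ContinuousOn.mul ?_ hcont) hF ?_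
      · refine Complex.continuous_ofReal.comp_continuousOn ?_
        exact continuousOn_id.rpow_const fun e he => Or.inl he.1.ne'
      · intro U y hU hy
        choose L hL using fun j => exists_tendsto_ultrafilter U
          (fun e : ℝ => ((e ^ (-x) : ℝ) : ℂ) * Y j e)
        obtain rfl := tendsto_nhds_unique hy (hL i)
        by_cases h1 : L i = OnePoint.infty
        · exact Or.inl h1
        · obtain ⟨a, ha⟩ := OnePoint.ne_infty_iff_exists.1 h1
          refine Or.inr ⟨a, ?_, ha⟩
          rw [Finset.mem_coe, Multiset.mem_toFinset, ← Multiset.count_pos, Polynomial.count_roots,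
            ← hUlim U hU L hL a, Finite.card_pos_iff]
          exact ⟨⟨i, ha.symm⟩⟩
    choose L hL using hconv
    exact hcount Y L (hUlim (Ultrafilter.of _) (Ultrafilter.of_le _) L fun i =>
      (hL i).mono_left (Ultrafilter.of_le _)) hL

/-! ### The limit of the rescaled characteristic polynomials -/

theorem tendsto_rpow_ofReal {x : ℝ} (hx : 0 < x) :
    Tendsto (fun e : ℝ => ((e ^ x : ℝ) : ℂ)) (𝓝[>] 0) (𝓝 0) := by
  have h := (Real.continuousAt_rpow_const 0 x (Or.inr hx.le)).tendsto
  rw [Real.zero_rpow hx.ne'] at h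
  exact (Complex.continuous_ofReal.tendsto' 0 0 Complex.ofReal_zero).comp
    (h.mono_left nhdsWithin_le_nhds)

/-- An entry with exponent at least `y`, divided by `ε^y`. -/
theorem Simeq.tendsto {f : ℝ → ℂ} {z : ℂ} {X : Rmin} (h : Simeq f z X) {y : ℝ}
    (hy : ∀ x, X = ofReal x → y ≤ x) [Decidable (X = ofReal y)] :
    Tendsto (fun e : ℝ => ((e ^ (-y) : ℝ) : ℂ) * f e) (𝓝[>] 0)
      (𝓝 (if X = ofReal y then z else 0)) := by
  by_cases hX : X = 0
  · rw [if_neg (by rw [hX]; exact (ofReal_ne_zero y).symm)]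
    refine tendsto_const_nhds.congr' ?_
    filter_upwards [h.1 hX] with e he
    rw [he, mul_zero]
  · obtain ⟨x, rfl⟩ := exists_ofReal_of_ne_zero hX
    have hx := h.2 x rfl
    rcases (hy x rfl).eq_or_lt with rfl | hlt
    · rw [if_pos rfl]
      exact hx
    · rw [if_neg fun h => hlt.ne' (ofReal_inj.1 h)]
      have := (tendsto_rpow_ofReal (sub_pos.2 hlt)).mul hx
      rw [zero_mul] at this
      refine this.congr' ?_
      filter_upwards [self_mem_nhdsWithin] with e he
      rw [← mul_assoc, ← Complex.ofReal_mul, ← Real.rpow_add he]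
      congr 3
      ring

/-- Rescaled by `D_ℓ` and a potential, the pencil converges. -/
theorem tendsto_charpoly {d v : ι → ℝ} (hv : ∀ i j x, A i j = ofReal x → d i + v i ≤ x + v j)
    {C : Finset ι} {r : ℝ} (hC : ∀ i ∈ C, d i < r) (hC' : ∀ i ∉ C, d i = r)
    {a : Matrix ι ι ℂ} {M : ℝ → Matrix ι ι ℂ}
    (hM : ∀ i j, Simeq (fun e => M e i j) (a i j) (A i j)) (z : ℂ) :
    Tendsto (fun e : ℝ => (∏ i, ((e ^ (-d i) : ℝ) : ℂ)) *
        (M e).charpoly.eval (((e ^ r : ℝ) : ℂ) * z)) (𝓝[>] 0)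
      (𝓝 (Matrix.diagonal (fun i => if i ∈ C then 0 else z) -
        maskMat (fun i j => A i j = ofReal (d i + v i - v j)) a).det) := by
  classical
  have hentry : Tendsto (fun e : ℝ => Matrix.of fun i j =>
      ((e ^ (-(d i + v i - v j)) : ℝ) : ℂ) *
        ((Matrix.scalar ι (((e ^ r : ℝ) : ℂ) * z) - M e) i j)) (𝓝[>] 0)
      (𝓝 (Matrix.diagonal (fun i => if i ∈ C then 0 else z) -
        maskMat (fun i j => A i j = ofReal (d i + v i - v j)) a)) := by
    refine tendsto_pi_nhds.2 fun i => tendsto_pi_nhds.2 fun j => ?_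
    simp only [Matrix.of_apply, Matrix.sub_apply, mul_sub]
    refine Tendsto.sub ?_ ?_
    · by_cases hij : i = j
      · subst hij
        simp only [Matrix.scalar_apply, Matrix.diagonal_apply_eq]
        have h1 : ∀ᶠ e : ℝ in 𝓝[>] 0, ((e ^ (r - d i) : ℝ) : ℂ) * z =
            ((e ^ (-(d i + v i - v i)) : ℝ) : ℂ) * (((e ^ r : ℝ) : ℂ) * z) := by
          filter_upwards [self_mem_nhdsWithin] with e he
          rw [← mul_assoc, ← Complex.ofReal_mul, ← Real.rpow_add he]
          congr 3
          ring
        refine Tendsto.congr' h1 ?_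
        by_cases hi : i ∈ C
        · rw [if_pos hi]
          simpa using (tendsto_rpow_ofReal (sub_pos.2 (hC i hi))).mul_const z
        · rw [if_neg hi, hC' i hi]
          simp
      · simp [Matrix.diagonal_apply_ne _ hij]
    · rw [maskMat, Matrix.of_apply]
      convert (hM i j).tendsto (y := d i + v i - v j) fun x hx => by
        have := hv i j x hx
        linarith
  refine (((Continuous.matrix_det continuous_id).tendsto _).comp hentry).congr' ?_
  filter_upwards [self_mem_nhdsWithin] with e he
  -- In the determinant of this product the potential cancels between rows and columns, which leaves
  -- the factor `∏ ε^{-d_i}`.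
  have hfac : (Matrix.of fun i j => ((e ^ (-(d i + v i - v j)) : ℝ) : ℂ) *
        ((Matrix.scalar ι (((e ^ r : ℝ) : ℂ) * z) - M e) i j)) =
      Matrix.diagonal (fun i => ((e ^ (-d i - v i) : ℝ) : ℂ)) *
        (Matrix.scalar ι (((e ^ r : ℝ) : ℂ) * z) - M e) *
        Matrix.diagonal (fun i => ((e ^ v i : ℝ) : ℂ)) := by
    ext i j
    rw [Matrix.mul_diagonal, Matrix.diagonal_mul, Matrix.of_apply,
      show -(d i + v i - v j) = (-d i - v i) + v j by ring, Real.rpow_add he, Complex.ofReal_mul]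
    ring
  simp only [Function.comp_apply, id]
  rw [hfac, Matrix.det_mul, Matrix.det_mul, Matrix.det_diagonal, Matrix.det_diagonal,
    Matrix.eval_charpoly, mul_right_comm, ← Finset.prod_mul_distrib]
  congr 1
  refine Finset.prod_congr rfl fun i _ => ?_
  rw [← Complex.ofReal_mul, ← Real.rpow_add he]
  congr 2
  ring

/-- The potential telescopes, so a closed walk of equality arcs has weight `∑ μ d`, the equality
case of `circuit_bound`. -/
theorem transGen_tight_walk {d v : ι → ℝ} {i j : ι}
    (h : Relation.TransGen (fun i j => A i j = ofReal (d i + v i - v j)) i j) :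
    ∃ μ, IsWalk A i j (∑ l, μ l * d l + v i - v j) μ ∧ 0 < μ i := by
  induction h using Relation.TransGen.head_induction_on with
  | @single i h =>
    refine ⟨Pi.single i 1, ?_, by simp⟩
    convert IsWalk.single h using 1
    simp [Pi.single_apply]
  | @head i k h _ ih =>
    obtain ⟨μ, hμ, -⟩ := ih
    refine ⟨Pi.single i 1 + μ, ?_, by simp⟩
    convert IsWalk.cons h hμ using 1
    simp [Pi.single_apply, add_mul, Finset.sum_add_distrib]
    ring

/-- The determinant of the limit pencil. -/
theorem det_pencil (hA : IsIrreducible A) {m : ℕ} (hm : m < numCrit A) {v : ι → ℝ}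
    {a : Matrix ι ι ℂ} {G : ι → ι → Prop}
    (hG : G = fun i j => A i j = ofReal (ordVal A (m + 1) i + v i - v j))
    (hr : IsUnit (rMat A G a (m + 1))) (z : ℂ) :
    (Matrix.diagonal (fun i => if i ∈ cumSet A m then 0 else z) - maskMat G a).det =
      (-rMat A G a (m + 1)).det * z ^ Fintype.card {i // ¬ i ∈ cumSet A (m + 1)} *
        (tMat A G a (m + 1)).charpoly.eval z := by
  classical
  set X := Matrix.diagonal (fun i => if i ∈ cumSet A m then 0 else z) - maskMat G a with hXdef
  have hcirc : ∀ i, i ∉ cumSet A (m + 1) → ¬ Relation.TransGen G i i := by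
    intro i hi h
    rw [hG] at h
    obtain ⟨μ, hμ, hp⟩ := transGen_tight_walk h
    exact hi ((circuit_bound hA hm hμ).2 (by linarith) i hp)
  have hmask : ∀ i j, ¬ G i j → maskMat G a i j = 0 := fun i j h => by simp [maskMat, h]
  have hdet : X.det = (X.toBlock (· ∈ cumSet A (m + 1)) (· ∈ cumSet A (m + 1))).det *
      ∏ i : {i // ¬ i ∈ cumSet A (m + 1)}, X i.1 i.1 := by
    convert det_eq_of_no_circuit X G (· ∈ cumSet A (m + 1)) (fun i j hij hne => by
      by_contra h
      exact hne (by simp [hXdef, hij, hmask i j h])) hcirc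
  have hr' : IsUnit ((maskMat G a).toBlock (· ∈ cumSet A m) (· ∈ cumSet A m)) := hr
  have hXC : X.toBlock (· ∈ cumSet A m) (· ∈ cumSet A m) = -rMat A G a (m + 1) := by
    ext i j
    simp [hXdef, rMat, Matrix.toBlock_apply, Matrix.diagonal_apply, i.2]
  have hdiag : ∏ i : {i // ¬ i ∈ cumSet A (m + 1)}, X i.1 i.1 =
      z ^ Fintype.card {i // ¬ i ∈ cumSet A (m + 1)} := by
    rw [← Finset.card_univ, ← Finset.prod_const]
    refine Finset.prod_congr rfl fun i _ => ?_
    -- Outside `C^{m+1}` the graph `G` has no loop either, so the diagonal entry is `z` alone.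
    have h1 : i.1 ∉ cumSet A m := fun h => i.2 (cumSet_mono (Nat.le_succ m) h)
    have h2 := hmask i.1 i.1 fun h => hcirc i.1 i.2 (.single h)
    simp [hXdef, h1, h2]
  have hschur : (schur (cumSet A m) X).toBlock (fun i => i.1 ∈ critSet A (m + 1))
      (fun i => i.1 ∈ critSet A (m + 1)) = Matrix.scalar _ z - tMat A G a (m + 1) := by
    rw [hXdef, schur_pencil _ _ hr']
    ext i j
    simp [tMat, sMat, Matrix.toBlock_apply, Matrix.diagonal_apply, Subtype.ext_iff]
  rw [hdet, hdiag, det_block_union (cumSet_succ m) X (by rw [hXC]; exact hr.neg), hXC, hschur,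
    Matrix.eval_charpoly]
  ring

theorem card_critSet_subtype (hA : IsIrreducible A) {m : ℕ} (hm : m < numCrit A) :
    Fintype.card {i : {i // i ∉ cumSet A m} // i.1 ∈ critSet A (m + 1)} =
      (critSet A (m + 1)).card := by
  rw [← Fintype.card_coe]
  exact Fintype.card_congr
    { toFun := fun i => ⟨i.1.1, i.2⟩
      invFun := fun i => ⟨⟨i.1, (isReduced hA hm.le).notMem_of_mem_critSet i.2⟩, i.2⟩
      left_inv := fun _ => rfl
      right_inv := fun _ => rfl }

/-- The graph used here is the equality graph of a potential for `D_ℓ`. It depends on `A` only, so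
the generic condition is fixed before `M`, and it contains the critical arcs of order `ℓ` because
zero-weight circuits are tight. -/
theorem generically_equivalentCount (hA : IsIrreducible A) {m : ℕ} (hm : m < numCrit A)
    (h : CritGraphHasCover A m) (h' : CritGraphHasCover A (m + 1)) :
    Generically fun a : Matrix ι ι ℂ => ∀ M : ℝ → Matrix ι ι ℂ,
      (∀ i j, Simeq (fun e => M e i j) (a i j) (A i j)) →
        EquivalentCount M (critVal A (m + 1)) (critSet A (m + 1)).card := by
  obtain ⟨v, hv⟩ := exists_potential hA (ordVal A (m + 1)) fun i x μ h => (circuit_bound hA hm h).1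
  set G : ι → ι → Prop := fun i j => A i j = ofReal (ordVal A (m + 1) i + v i - v j) with hG
  refine (generically_isUnit hA hm h h' (G := G) ?_).mono fun a ⟨hr, ht⟩ M hM => ?_
  · rintro _ _ ⟨k, c, hc, p, hp, rfl, rfl⟩
    obtain ⟨hc, hx⟩ := (isCriticalCircuitOfOrder_iff hA hm).1 hc
    exact tight_arcs hv hc hx.le hp
  have hdeg := Matrix.charpoly_natDegree_eq_dim (tMat A G a (m + 1))
  rw [← card_critSet_subtype hA hm]
  refine hdeg ▸ equivalentCount_of_tendsto (c := (-rMat A G a (m + 1)).det)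
    (t := Fintype.card {i // ¬ i ∈ cumSet A (m + 1)}) (κ := fun e =>
      ∏ i, ((e ^ (-ordVal A (m + 1) i) : ℝ) : ℂ)) ?_ ?_ fun z => ?_
  · exact ((Matrix.isUnit_iff_isUnit_det _).1 hr.neg).ne_zero
  · rw [Matrix.eval_charpoly, map_zero, zero_sub]
    exact ((Matrix.isUnit_iff_isUnit_det _).1 ht.neg).ne_zero
  · rw [← det_pencil hA hm hG hr z]
    exact tendsto_charpoly hv (fun i hi => ordVal_lt hA hm hi)
      (fun i hi => by simp [ordVal, hi]) hM z

end MinPlus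

theorem mainTheorem7 (n : ℕ) (A : Matrix (Fin n) (Fin n) MinPlus.Rmin)
    (hA : MinPlus.IsIrreducible A) (l : ℕ) (hl : 1 ≤ l) (hlk : l ≤ MinPlus.numCrit A)
    (hcover : MinPlus.CritGraphHasCover A (l - 1)) (hcover' : MinPlus.CritGraphHasCover A l) :
    (∀ G : Fin n → Fin n → Prop, MinPlus.IsAdmissibleGraph A G →
      MinPlus.Generically (fun a : Matrix (Fin n) (Fin n) ℂ =>
        IsUnit (MinPlus.rMat A G a l) ∧ IsUnit (MinPlus.tMat A G a l))) ∧
    MinPlus.Generically (fun a : Matrix (Fin n) (Fin n) ℂ =>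
      ∀ M : ℝ → Matrix (Fin n) (Fin n) ℂ,
        (∀ i j, MinPlus.IsGerm (fun e => M e i j)) →
        (∀ i j, MinPlus.Simeq (fun e => M e i j) (a i j) (A i j)) →
        MinPlus.EquivalentCount M (MinPlus.critVal A l) (MinPlus.critSet A l).card) := by
  obtain ⟨m, rfl⟩ := Nat.exists_eq_add_of_le' hl
  exact ⟨fun G hG => MinPlus.generically_isUnit hA hlk hcover hcover'
      fun i j h => hG.of_critical hA hlk h,
    (MinPlus.generically_equivalentCount hA hlk hcover hcover').mono fun a ha M _ hM => ha M hM⟩
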